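/- **Lemma (universal instance of the refined 5-lemma).** *Conventions.* Composition is written from left to right, and matrices act on rows: the $(k,l)$ entry of a matrix $X_1\oplus\dots\oplus X_m\to Y_1\oplus\dots\oplus Y_n$ is a morphism $X_k\to Y_l$. For an additive category $\mathbf A$, the Adelman category $\mathrm{Adel}(\mathbf A)$ has as objects the composable pairs $(r\xrightarrow{\rho}a\xrightarrow{\gamma}c)$ in $\mathbf A$ (no condition on $\rho\gamma$). A morphism $[\alpha]$ from $(r_a\xrightarrow{\rho_a}a\xrightarrow{\gamma_a}c_a)$ to $(r_b\xrightarrow{\rho_b}b\xrightarrow{\gamma_b}c_b)$ is given by $\alpha:a\to b$ for which there are $\omega:r_a\to r_b$ and $\psi:c_a\to c_b$ (relation and corelation witness) with $\rho_a\alpha=\omega\rho_b$ and $\alpha\gamma_b=\gamma_a\psi$; we put $[\alpha]=[\alpha']$ iff $\alpha-\alpha'=\sigma_1\rho_b+\gamma_a\sigma_2$ for some $\sigma_1:a\to r_b$, $\sigma_2:c_a\to b$ (a witness pair). The category $\mathrm{Adel}(\mathbf A)$ is abelian, and $a\mapsto(0\to a\to 0)$ embeds $\mathbf A$ into it. In an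 abelian category, $\mathrm H(x\xrightarrow{\varphi}y\xrightarrow{\psi}z)$ denotes the image of $\ker\psi\to y\to\operatorname{coker}\varphi$, for any composable pair, and it is functorial in the pair. Let $Q$ be the quiver with nodes $i,a,b,c,f,g,h,j$ and arrows $$\lambda:i\to a,\quad \alpha:a\to b,\quad \beta:b\to c,\quad \epsilon:b\to f,\quad \zeta:c\to g,\quad \iota:f\to g,\quad \kappa:g\to h,\quad \mu:h\to j,$$ and let $R$ be the relations $$\alpha\beta=0,\qquad \iota\kappa=0,\qquad \beta\zeta=\epsilon\iota,\qquad \lambda\alpha\epsilon=0,\qquad \zeta\kappa\mu=0.$$ Let $\mathcal C(Q,R)$ be the $\mathbb Z$-linear category with the nodes of $Q$ as objects and $\mathbb Z$-linear combinations of paths modulo $R$ as morphisms, and let $\mathcal C(Q,R)^{\oplus}$ be its additive closure (finite tuples and matrices). Consider the following diagram in $\mathrm{Adel}(\mathcal C(Q,R)^{\oplus})$: $$\begin{array}{ccccccc} (0\to a\to 0)&\xrightarrow{[\alpha]}&(0\to b\to 0)&\xrightarrow{[\beta]}&(0\to c\to 0)&\xrightarrow{[\zeta\kappa]}&(0\to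 h\xrightarrow{\mu}j)\\ \downarrow{\scriptstyle\delta=[\mathrm{id}_a]}&&\downarrow{\scriptstyle[\epsilon]}&&\downarrow{\scriptstyle[\zeta]}&&\downarrow{\scriptstyle\eta=[\mathrm{id}_h]}\\ (i\xrightarrow{\lambda}a\to 0)&\xrightarrow{\theta=[\alpha\epsilon]}&(0\to f\to 0)&\xrightarrow{[\iota]}&(0\to g\to 0)&\xrightarrow{[\kappa]}&(0\to h\to 0) \end{array}$$ Then the diagram is well defined and commutes, and the following holds. 1. (Premise of the refined 5-lemma.) The composition of any two consecutive horizontal morphisms is zero, $\delta$ is an epimorphism and $\eta$ is a monomorphism. 2. (Conclusion of the refined 5-lemma.) Write $\gamma=[\zeta\kappa]$, and $\alpha,\beta,\epsilon,\zeta,\iota$ for the morphisms $[\alpha],[\beta],[\epsilon],[\zeta],[\iota]$. There is a monomorphism $$\mathrm H\big(\ker\epsilon\to\ker\zeta\to\mathrm H(\beta,\gamma)\big)\hookrightarrow\operatorname{coker}\big(\mathrm H(\alpha,\beta)\xrightarrow{\mathrm H(\epsilon)}\mathrm H(\theta,\iota)\big).$$ The object $\ker\zeta$ has a filtration $0\le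 F_1\le F_2\le\ker\zeta$ such that $F_1$, $F_2/F_1$ and $\ker\zeta/F_2$ are subquotients of $\ker\epsilon$, $\mathrm H(\theta,\iota)$ and $\mathrm H(\beta,\gamma)$, respectively. If these three objects are zero, then $\zeta$ is a monomorphism. 3. (Explicit form.) The source and the target of the monomorphism in 2 are isomorphic, respectively, to $$X=\Big(b\oplus b\xrightarrow{\left(\begin{smallmatrix}\beta&\epsilon&0\\0&0&\mathrm{id}\end{smallmatrix}\right)}c\oplus f\oplus b\xrightarrow{\left(\begin{smallmatrix}\zeta&0&\mathrm{id}\\0&\mathrm{id}&0\\0&0&\beta\end{smallmatrix}\right)}g\oplus f\oplus c\Big),\qquad Y=\Big(a\oplus b\xrightarrow{\left(\begin{smallmatrix}\alpha\epsilon&0\\\epsilon&\beta\end{smallmatrix}\right)}f\oplus c\xrightarrow{\left(\begin{smallmatrix}\iota&0\\0&\mathrm{id}\end{smallmatrix}\right)}g\oplus c\Big),$$ and the morphism $m:X\to Y$ with datum $\left(\begin{smallmatrix}0&\mathrm{id}\\\mathrm{id}&0\\\epsilon&\beta\end{smallmatrix}\right)$, relation witness $\left(\begin{smallmatrix}0&\mathrm{id}\\0&\mathrm{id}\end{smallmatrix}\right)$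 and corelation witness $\left(\begin{smallmatrix}-\mathrm{id}&0\\\iota&0\\\zeta&\mathrm{id}\end{smallmatrix}\right)$ is a well-defined monomorphism. A kernel of $m$ is given by the object $$K=\big(b\oplus b\oplus a\oplus b\xrightarrow{\rho_K}c\oplus f\oplus b\oplus a\oplus b\xrightarrow{\gamma_K}g\oplus f\oplus c\oplus f\oplus c\big),$$ $$\rho_K=\left(\begin{smallmatrix}\beta&\epsilon&0&0&0\\0&0&\mathrm{id}&0&0\\0&0&0&\mathrm{id}&0\\0&0&0&0&\mathrm{id}\end{smallmatrix}\right),\qquad \gamma_K=\left(\begin{smallmatrix}\zeta&0&\mathrm{id}&0&\mathrm{id}\\0&\mathrm{id}&0&\mathrm{id}&0\\0&0&\beta&\epsilon&\beta\\0&0&0&\alpha\epsilon&0\\0&0&0&\epsilon&\beta\end{smallmatrix}\right),$$ with embedding $K\to X$ the projection onto the first three summands (with the projections onto the first two and the first three summands as relation and corelation witness), and $$\mathrm{id}=\sigma_1\rho_K+\gamma_K\sigma_2,\qquad \sigma_1=\left(\begin{smallmatrix}0&0&0&0\\0&0&0&0\\-\mathrm{id}&\mathrm{id}&0&0\\-\alpha&0&\mathrm{id}&0\\-\mathrm{id}&0&0&\mathrm{id}\end{smallmatrix}\right),\qquad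 \sigma_2=\left(\begin{smallmatrix}0&0&0&0&0\\0&0&0&0&0\\0&0&0&0&0\\0&\mathrm{id}&0&0&0\\\mathrm{id}&0&0&0&0\end{smallmatrix}\right),$$ so that $(\sigma_1,\sigma_2)$ is a witness pair for the identity of $K$ being zero. -/

import Mathlib

open CategoryTheory CategoryTheory.Limits

universe v u

/-! ### The Adelman category of an additive category -/

/-- Objects of the Adelman category: composable pairs `(r --ρ--> mid --γ--> c)`
(no condition on `ρ ≫ γ`). -/
structure Adel (A : Type u) [Category.{v} A] where
  {r : A}
  {mid : A}
  {c : A}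
  ρ : r ⟶ mid
  γ : mid ⟶ c

namespace Adel

noncomputable section

variable {A : Type u} [Category.{v} A] [Preadditive A]

/-- Morphism data: those `α : X.mid ⟶ Y.mid` which admit a relation witness `ω` and
a corelation witness `ψ`. -/
def homData (X Y : Adel A) : AddSubgroup (X.mid ⟶ Y.mid) where
  carrier := {α | (∃ ω : X.r ⟶ Y.r, X.ρ ≫ α = ω ≫ Y.ρ) ∧ (∃ ψ : X.c ⟶ Y.c, α ≫ Y.γ = X.γ ≫ ψ)}
  zero_mem' := ⟨⟨0, by simp⟩, ⟨0, by simp⟩⟩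
  add_mem' := by
    rintro a b ⟨⟨ω, h⟩, ⟨ψ, h'⟩⟩ ⟨⟨ω₂, k⟩, ⟨ψ₂, k'⟩⟩
    exact ⟨⟨ω + ω₂, by simp [h, k]⟩, ⟨ψ + ψ₂, by simp [h', k']⟩⟩
  neg_mem' := by
    rintro a ⟨⟨ω, h⟩, ⟨ψ, h'⟩⟩
    exact ⟨⟨-ω, by simp [h]⟩, ⟨-ψ, by simp [h']⟩⟩

/-- Those `α : X.mid ⟶ Y.mid` of the form `σ₁ ≫ Y.ρ + X.γ ≫ σ₂`;
`(σ₁, σ₂)` is a witness pair for `α` being zero. -/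
def nullData (X Y : Adel A) : AddSubgroup (X.mid ⟶ Y.mid) where
  carrier := {α | ∃ (σ₁ : X.mid ⟶ Y.r) (σ₂ : X.c ⟶ Y.mid), α = σ₁ ≫ Y.ρ + X.γ ≫ σ₂}
  zero_mem' := ⟨0, 0, by simp⟩
  add_mem' := by
    rintro a b ⟨s, t, h⟩ ⟨s', t', h'⟩
    exact ⟨s + s', t + t', by simp [h, h']; abel⟩
  neg_mem' := by
    rintro a ⟨s, t, h⟩
    exact ⟨-s, -t, by simp [h]; abel⟩

/-- Morphisms of the Adelman category: morphism data modulo those with a witness pair. -/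
def Hom (X Y : Adel A) : Type v := homData X Y ⧸ (nullData X Y).addSubgroupOf (homData X Y)

instance (X Y : Adel A) : AddCommGroup (Hom X Y) :=
  inferInstanceAs (AddCommGroup (homData X Y ⧸ (nullData X Y).addSubgroupOf (homData X Y)))

theorem comp_mem {X Y Z : Adel A} {f : X.mid ⟶ Y.mid} {g : Y.mid ⟶ Z.mid}
    (hf : f ∈ homData X Y) (hg : g ∈ homData Y Z) : f ≫ g ∈ homData X Z := by
  obtain ⟨⟨ω, h⟩, ⟨ψ, h'⟩⟩ := hf
  obtain ⟨⟨ω₂, k⟩, ⟨ψ₂, k'⟩⟩ := hg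
  refine ⟨⟨ω ≫ ω₂, ?_⟩, ⟨ψ ≫ ψ₂, ?_⟩⟩
  · rw [reassoc_of% h, k, Category.assoc]
  · rw [Category.assoc, k', reassoc_of% h']

theorem comp_null {X Y Z : Adel A} {f : X.mid ⟶ Y.mid} {g : Y.mid ⟶ Z.mid}
    (hf : f ∈ homData X Y) (hg : g ∈ nullData Y Z) : f ≫ g ∈ nullData X Z := by
  obtain ⟨-, ⟨ψ, h'⟩⟩ := hf
  obtain ⟨s, t, rfl⟩ := hg
  exact ⟨f ≫ s, ψ ≫ t, by simp [reassoc_of% h']⟩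

theorem null_comp {X Y Z : Adel A} {f : X.mid ⟶ Y.mid} {g : Y.mid ⟶ Z.mid}
    (hf : f ∈ nullData X Y) (hg : g ∈ homData Y Z) : f ≫ g ∈ nullData X Z := by
  obtain ⟨⟨ω, h⟩, -⟩ := hg
  obtain ⟨s, t, rfl⟩ := hf
  exact ⟨s ≫ ω, t ≫ g, by simp [h]⟩

/-- The class of a morphism datum. -/
def Hom.ofData {X Y : Adel A} (f : homData X Y) : Hom X Y := QuotientAddGroup.mk f

theorem Hom.ofData_eq {X Y : Adel A} (f g : homData X Y) :
    Hom.ofData f = Hom.ofData g ↔ (f : X.mid ⟶ Y.mid) - g ∈ nullData X Y := by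
  refine (eq_comm.trans QuotientAddGroup.eq).trans ?_
  rw [AddSubgroup.mem_addSubgroupOf]
  simp [neg_add_eq_sub]

theorem Hom.ofData_surjective {X Y : Adel A} (f : Hom X Y) : ∃ g, f = Hom.ofData g := by
  obtain ⟨g, rfl⟩ := QuotientAddGroup.mk_surjective f
  exact ⟨g, rfl⟩

/-- Composition of classes of morphism data. -/
def Hom.comp {X Y Z : Adel A} (f : Hom X Y) (g : Hom Y Z) : Hom X Z :=
  Quotient.map₂ (fun (f : homData X Y) (g : homData Y Z) =>
      (⟨f.1 ≫ g.1, comp_mem f.2 g.2⟩ : homData X Z))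
    (by
      intro f f' hf g g' hg
      replace hf := AddSubgroup.mem_addSubgroupOf.1 (QuotientAddGroup.leftRel_apply.1 hf)
      replace hg := AddSubgroup.mem_addSubgroupOf.1 (QuotientAddGroup.leftRel_apply.1 hg)
      refine QuotientAddGroup.leftRel_apply.2 (AddSubgroup.mem_addSubgroupOf.2 ?_)
      have : (((-(⟨f.1 ≫ g.1, comp_mem f.2 g.2⟩ : homData X Z) +
          ⟨f'.1 ≫ g'.1, comp_mem f'.2 g'.2⟩ : homData X Z)) : X.mid ⟶ Z.mid) =
          ((-f + f' : homData X Y) : X.mid ⟶ Y.mid) ≫ g.1 +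
          f'.1 ≫ ((-g + g' : homData Y Z) : Y.mid ⟶ Z.mid) := by
        simp
      rw [this]
      exact add_mem (null_comp hf g.2) (comp_null f'.2 hg)) f g

instance : Category.{v} (Adel A) where
  Hom := Hom
  id X := Hom.ofData ⟨𝟙 X.mid, ⟨𝟙 _, by simp⟩, ⟨𝟙 _, by simp⟩⟩
  comp := Hom.comp
  id_comp f := by
    obtain ⟨f, rfl⟩ := Hom.ofData_surjective f
    exact congrArg Hom.ofData (Subtype.ext (Category.id_comp _))
  comp_id f := by
    obtain ⟨f, rfl⟩ := Hom.ofData_surjective f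
    exact congrArg Hom.ofData (Subtype.ext (Category.comp_id _))
  assoc f g h := by
    obtain ⟨f, rfl⟩ := Hom.ofData_surjective f
    obtain ⟨g, rfl⟩ := Hom.ofData_surjective g
    obtain ⟨h, rfl⟩ := Hom.ofData_surjective h
    exact congrArg Hom.ofData (Subtype.ext (Category.assoc _ _ _))

instance : Preadditive (Adel A) where
  homGroup X Y := inferInstanceAs (AddCommGroup (Hom X Y))
  add_comp X Y Z f f' g := by
    obtain ⟨f, rfl⟩ := Hom.ofData_surjective f
    obtain ⟨f', rfl⟩ := Hom.ofData_surjective f'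
    obtain ⟨g, rfl⟩ := Hom.ofData_surjective g
    exact congrArg Hom.ofData (Subtype.ext (Preadditive.add_comp _ _ _ _ _ _))
  comp_add X Y Z f g g' := by
    obtain ⟨f, rfl⟩ := Hom.ofData_surjective f
    obtain ⟨g, rfl⟩ := Hom.ofData_surjective g
    obtain ⟨g', rfl⟩ := Hom.ofData_surjective g'
    exact congrArg Hom.ofData (Subtype.ext (Preadditive.comp_add _ _ _ _ _ _))

/-- The morphism `{ω, α, ψ}` of the Adelman category given by a morphism datum `α`,
a relation witness `ω` and a corelation witness `ψ`. -/
def homMk {X Y : Adel A} (α : X.mid ⟶ Y.mid) (ω : X.r ⟶ Y.r) (ψ : X.c ⟶ Y.c)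
    (hω : X.ρ ≫ α = ω ≫ Y.ρ) (hψ : α ≫ Y.γ = X.γ ≫ ψ) : X ⟶ Y :=
  Hom.ofData ⟨α, ⟨ω, hω⟩, ⟨ψ, hψ⟩⟩

theorem exists_homMk {X Y : Adel A} (f : X ⟶ Y) : ∃ α ω ψ hω hψ, f = homMk α ω ψ hω hψ := by
  obtain ⟨⟨α, ⟨ω, hω⟩, ⟨ψ, hψ⟩⟩, rfl⟩ := Hom.ofData_surjective f
  exact ⟨α, ω, ψ, hω, hψ, rfl⟩

theorem homMk_comp {X Y Z : Adel A} {α : X.mid ⟶ Y.mid} {ω : X.r ⟶ Y.r} {ψ : X.c ⟶ Y.c}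
    (hω : X.ρ ≫ α = ω ≫ Y.ρ) (hψ : α ≫ Y.γ = X.γ ≫ ψ)
    {α' : Y.mid ⟶ Z.mid} {ω' : Y.r ⟶ Z.r} {ψ' : Y.c ⟶ Z.c}
    (hω' : Y.ρ ≫ α' = ω' ≫ Z.ρ) (hψ' : α' ≫ Z.γ = Y.γ ≫ ψ') :
    homMk α ω ψ hω hψ ≫ homMk α' ω' ψ' hω' hψ' =
      homMk (α ≫ α') (ω ≫ ω') (ψ ≫ ψ')
        (by rw [reassoc_of% hω, hω', Category.assoc])
        (by rw [Category.assoc, hψ', reassoc_of% hψ]) := rfl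

theorem homMk_eq_iff {X Y : Adel A} {α α' : X.mid ⟶ Y.mid} {ω ω' : X.r ⟶ Y.r} {ψ ψ' : X.c ⟶ Y.c}
    (hω : X.ρ ≫ α = ω ≫ Y.ρ) (hψ : α ≫ Y.γ = X.γ ≫ ψ)
    (hω' : X.ρ ≫ α' = ω' ≫ Y.ρ) (hψ' : α' ≫ Y.γ = X.γ ≫ ψ') :
    homMk α ω ψ hω hψ = homMk α' ω' ψ' hω' hψ' ↔
      ∃ (σ₁ : X.mid ⟶ Y.r) (σ₂ : X.c ⟶ Y.mid), α - α' = σ₁ ≫ Y.ρ + X.γ ≫ σ₂ :=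
  Hom.ofData_eq _ _

theorem homMk_eq_zero_iff {X Y : Adel A} {α : X.mid ⟶ Y.mid} {ω : X.r ⟶ Y.r} {ψ : X.c ⟶ Y.c}
    (hω : X.ρ ≫ α = ω ≫ Y.ρ) (hψ : α ≫ Y.γ = X.γ ≫ ψ) :
    homMk α ω ψ hω hψ = 0 ↔
      ∃ (σ₁ : X.mid ⟶ Y.r) (σ₂ : X.c ⟶ Y.mid), α = σ₁ ≫ Y.ρ + X.γ ≫ σ₂ := by
  have := homMk_eq_iff hω hψ (α' := 0) (ω' := 0) (ψ' := 0) (by simp) (by simp)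
  rw [sub_zero] at this
  exact this

/-! ### Kernels and cokernels -/

variable [HasFiniteBiproducts A]

attribute [local instance] hasBinaryBiproducts_of_finite_biproducts

section Kernels

variable {X Y : Adel A} {α : X.mid ⟶ Y.mid} {ω : X.r ⟶ Y.r} {ψ : X.c ⟶ Y.c}
  (hω : X.ρ ≫ α = ω ≫ Y.ρ) (hψ : α ≫ Y.γ = X.γ ≫ ψ)

/-- The kernel object of the morphism with datum `α`. -/
abbrev kerObj (X Y : Adel A) (α : X.mid ⟶ Y.mid) : Adel A where
  r := X.r ⊞ Y.r
  mid := X.mid ⊞ Y.r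
  c := X.c ⊞ Y.mid
  ρ := biprod.map X.ρ (𝟙 _)
  γ := biprod.desc (biprod.lift X.γ α) (biprod.lift 0 Y.ρ)

/-- The kernel embedding. -/
def kerι (X Y : Adel A) (α : X.mid ⟶ Y.mid) : kerObj X Y α ⟶ X :=
  homMk (X := kerObj X Y α) (Y := X) biprod.fst biprod.fst biprod.fst
    (by simp [kerObj]) (by dsimp [kerObj]; ext <;> simp)

theorem kerι_comp : kerι X Y α ≫ homMk α ω ψ hω hψ = 0 := by
  unfold kerι
  rw [homMk_comp, homMk_eq_zero_iff]
  exact ⟨-biprod.snd, biprod.snd, by dsimp [kerObj]; ext <;> simp⟩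

instance : Mono (kerι X Y α) := by
  rw [Preadditive.mono_iff_cancel_zero]
  intro T τ h
  obtain ⟨τ, ω', ψ', h1, h2, rfl⟩ := exists_homMk τ
  unfold kerι at h
  rw [homMk_comp, homMk_eq_zero_iff] at h
  obtain ⟨s, t, h⟩ := h
  rw [homMk_eq_zero_iff]
  refine ⟨biprod.lift s (τ ≫ biprod.snd), biprod.lift t 0, ?_⟩
  dsimp [kerObj] at *
  ext <;> simp [h]

theorem kerι_lift {T : Adel A} (k : T ⟶ X) (hk : k ≫ homMk α ω ψ hω hψ = 0) :
    ∃ l : T ⟶ kerObj X Y α, l ≫ kerι X Y α = k := by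
  obtain ⟨τ, ω', ψ', h1, h2, rfl⟩ := exists_homMk k
  rw [homMk_comp, homMk_eq_zero_iff] at hk
  obtain ⟨s, t, h⟩ := hk
  refine ⟨homMk (X := T) (Y := kerObj X Y α) (biprod.lift τ (-s))
    (biprod.lift ω' (-(T.ρ ≫ s))) (biprod.lift ψ' t) ?_ ?_, ?_⟩
  · dsimp [kerObj]; ext <;> simp [h1]
  · dsimp [kerObj]; ext <;> simp [h2, h]
  · unfold kerι
    rw [homMk_comp]
    congr 1 <;> simp

/-- The kernel embedding is a kernel. -/
def kerIsLimit : IsLimit (KernelFork.ofι (kerι X Y α) (kerι_comp hω hψ)) :=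
  KernelFork.IsLimit.ofι _ _ (fun k hk => (kerι_lift hω hψ k hk).choose)
    (fun k hk => (kerι_lift hω hψ k hk).choose_spec)
    (fun k hk m hm => by
      rw [← cancel_mono (kerι X Y α), hm, (kerι_lift hω hψ k hk).choose_spec])

/-- The cokernel object of the morphism with datum `α`. -/
abbrev cokerObj (X Y : Adel A) (α : X.mid ⟶ Y.mid) : Adel A where
  r := Y.r ⊞ X.mid
  mid := Y.mid ⊞ X.c
  c := Y.c ⊞ X.c
  ρ := biprod.desc (biprod.lift Y.ρ 0) (biprod.lift α X.γ)
  γ := biprod.map Y.γ (𝟙 _)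

/-- The cokernel projection. -/
def cokerπ (X Y : Adel A) (α : X.mid ⟶ Y.mid) : Y ⟶ cokerObj X Y α :=
  homMk (X := Y) (Y := cokerObj X Y α) biprod.inl biprod.inl biprod.inl
    (by dsimp [cokerObj]; ext <;> simp) (by simp [cokerObj])

theorem comp_cokerπ : homMk α ω ψ hω hψ ≫ cokerπ X Y α = 0 := by
  unfold cokerπ
  rw [homMk_comp, homMk_eq_zero_iff]
  exact ⟨biprod.inr, -biprod.inr, by dsimp [cokerObj]; ext <;> simp⟩

instance : Epi (cokerπ X Y α) := by
  rw [Preadditive.epi_iff_cancel_zero]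
  intro T τ h
  obtain ⟨τ, ω', ψ', h1, h2, rfl⟩ := exists_homMk τ
  unfold cokerπ at h
  rw [homMk_comp, homMk_eq_zero_iff] at h
  obtain ⟨s, t, h⟩ := h
  rw [homMk_eq_zero_iff]
  refine ⟨biprod.desc s 0, biprod.desc t (biprod.inr ≫ τ), ?_⟩
  dsimp [cokerObj] at *
  ext <;> simp [h]

theorem cokerπ_desc {T : Adel A} (k : Y ⟶ T) (hk : homMk α ω ψ hω hψ ≫ k = 0) :
    ∃ l : cokerObj X Y α ⟶ T, cokerπ X Y α ≫ l = k := by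
  obtain ⟨τ, ω', ψ', h1, h2, rfl⟩ := exists_homMk k
  rw [homMk_comp, homMk_eq_zero_iff] at hk
  obtain ⟨s, t, h⟩ := hk
  refine ⟨homMk (X := cokerObj X Y α) (Y := T) (biprod.desc τ (-t))
    (biprod.desc ω' s) (biprod.desc ψ' (-(t ≫ T.γ))) ?_ ?_, ?_⟩
  · dsimp [cokerObj]; ext <;> simp [h1, h]
  · dsimp [cokerObj]; ext <;> simp [h2]
  · unfold cokerπ
    rw [homMk_comp]
    congr 1 <;> simp

/-- The cokernel projection is a cokernel. -/
def cokerIsColimit : IsColimit (CokernelCofork.ofπ (cokerπ X Y α) (comp_cokerπ hω hψ)) :=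
  CokernelCofork.IsColimit.ofπ _ _ (fun k hk => (cokerπ_desc hω hψ k hk).choose)
    (fun k hk => (cokerπ_desc hω hψ k hk).choose_spec)
    (fun k hk m hm => by
      rw [← cancel_epi (cokerπ X Y α), hm, (cokerπ_desc hω hψ k hk).choose_spec])

/-- Every morphism killed by the kernel of an epimorphism factors through the epimorphism. -/
theorem epi_desc [Epi (homMk α ω ψ hω hψ)] {T : Adel A} (k : X ⟶ T)
    (hk : kerι X Y α ≫ k = 0) : ∃ l : Y ⟶ T, homMk α ω ψ hω hψ ≫ l = k := by
  have hz : cokerπ X Y α = 0 := by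
    rw [← cancel_epi (homMk α ω ψ hω hψ), comp_cokerπ, comp_zero]
  unfold cokerπ at hz
  rw [homMk_eq_zero_iff] at hz
  obtain ⟨σ, σ', hσ⟩ := hz
  obtain ⟨τ, ω', ψ', h1, h2, rfl⟩ := exists_homMk k
  unfold kerι at hk
  rw [homMk_comp, homMk_eq_zero_iff] at hk
  obtain ⟨s, t, h⟩ := hk
  obtain ⟨σ₁, hσ₁⟩ : ∃ x, x = σ ≫ biprod.fst := ⟨_, rfl⟩
  obtain ⟨σ₂, hσ₂⟩ : ∃ x, x = σ ≫ biprod.snd := ⟨_, rfl⟩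
  obtain ⟨p₁, hp₁⟩ : ∃ x, x = σ' ≫ biprod.fst := ⟨_, rfl⟩
  obtain ⟨p₂, hp₂⟩ : ∃ x, x = σ' ≫ biprod.snd := ⟨_, rfl⟩
  obtain ⟨s₁, hs₁⟩ : ∃ x, x = biprod.inl ≫ s := ⟨_, rfl⟩
  obtain ⟨s₂, hs₂⟩ : ∃ x, x = biprod.inr ≫ s := ⟨_, rfl⟩
  obtain ⟨t₁, ht₁⟩ : ∃ x, x = biprod.inl ≫ t := ⟨_, rfl⟩
  obtain ⟨t₂, ht₂⟩ : ∃ x, x = biprod.inr ≫ t := ⟨_, rfl⟩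
  obtain rfl : σ = biprod.lift σ₁ σ₂ := by ext <;> simp [hσ₁, hσ₂]
  obtain rfl : σ' = biprod.lift p₁ p₂ := by ext <;> simp [hp₁, hp₂]
  obtain rfl : s = biprod.desc s₁ s₂ := by ext <;> simp [hs₁, hs₂]
  obtain rfl : t = biprod.desc t₁ t₂ := by ext <;> simp [ht₁, ht₂]
  have e1 : τ = s₁ ≫ T.ρ + (X.γ ≫ t₁ + α ≫ t₂) := by
    simpa [biprod.lift_desc] using congrArg (biprod.inl ≫ ·) h
  have e2 : 0 = s₂ ≫ T.ρ + Y.ρ ≫ t₂ := by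
    simpa [biprod.lift_desc] using congrArg (biprod.inr ≫ ·) h
  have e3 : 𝟙 _ = σ₁ ≫ Y.ρ + σ₂ ≫ α + Y.γ ≫ p₁ := by
    simpa [biprod.lift_desc] using congrArg (· ≫ biprod.fst) hσ
  have e4 : 0 = σ₂ ≫ X.γ + Y.γ ≫ p₂ := by
    simpa [biprod.lift_desc] using congrArg (· ≫ biprod.snd) hσ
  have e2' : Y.ρ ≫ t₂ = -(s₂ ≫ T.ρ) := (neg_eq_of_add_eq_zero_right e2.symm).symm
  have e3' : Y.γ ≫ p₁ = 𝟙 _ - σ₁ ≫ Y.ρ - σ₂ ≫ α := by rw [e3]; abel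
  have e4' : σ₂ ≫ X.γ = -(Y.γ ≫ p₂) := (neg_eq_of_add_eq_zero_left e4.symm).symm
  have hu : σ₂ ≫ τ + Y.γ ≫ p₂ ≫ t₁ + Y.γ ≫ p₁ ≫ t₂ =
      t₂ + (σ₂ ≫ s₁ + σ₁ ≫ s₂) ≫ T.ρ := by
    rw [e1, reassoc_of% e3']
    simp only [Preadditive.comp_add, Preadditive.add_comp, Preadditive.sub_comp, Category.assoc,
      Category.id_comp, reassoc_of% e4', e2', Preadditive.neg_comp, Preadditive.comp_neg]
    abel
  refine ⟨homMk (σ₂ ≫ τ + Y.γ ≫ p₂ ≫ t₁ + Y.γ ≫ p₁ ≫ t₂)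
    (-s₂ + Y.ρ ≫ (σ₂ ≫ s₁ + σ₁ ≫ s₂)) (-(p₂ ≫ ψ') + p₂ ≫ t₁ ≫ T.γ + p₁ ≫ t₂ ≫ T.γ) ?_ ?_, ?_⟩
  · rw [hu]
    simp only [Preadditive.comp_add, Preadditive.add_comp, Category.assoc, e2',
      Preadditive.neg_comp]
  · simp only [Preadditive.comp_add, Preadditive.add_comp, Category.assoc, h2, reassoc_of% e4',
      Preadditive.neg_comp, Preadditive.comp_neg]
  · rw [homMk_comp, homMk_eq_iff]
    refine ⟨α ≫ (σ₂ ≫ s₁ + σ₁ ≫ s₂) - s₁, -t₁, ?_⟩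
    rw [hu, e1]
    simp only [Preadditive.comp_add, Preadditive.add_comp, Preadditive.sub_comp, Category.assoc,
      Preadditive.comp_neg]
    abel

/-- Every morphism killed by the cokernel of a monomorphism lifts along the monomorphism. -/
theorem mono_lift [Mono (homMk α ω ψ hω hψ)] {T : Adel A} (k : T ⟶ Y)
    (hk : k ≫ cokerπ X Y α = 0) : ∃ l : T ⟶ X, l ≫ homMk α ω ψ hω hψ = k := by
  have hz : kerι X Y α = 0 := by
    rw [← cancel_mono (homMk α ω ψ hω hψ), kerι_comp, zero_comp]
  unfold kerι at hz
  rw [homMk_eq_zero_iff] at hz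
  obtain ⟨σ, σ', hσ⟩ := hz
  obtain ⟨τ, ω', ψ', h1, h2, rfl⟩ := exists_homMk k
  unfold cokerπ at hk
  rw [homMk_comp, homMk_eq_zero_iff] at hk
  obtain ⟨s, t, h⟩ := hk
  obtain ⟨σ₁, hσ₁⟩ : ∃ x, x = biprod.inl ≫ σ := ⟨_, rfl⟩
  obtain ⟨σ₂, hσ₂⟩ : ∃ x, x = biprod.inr ≫ σ := ⟨_, rfl⟩
  obtain ⟨p₁, hp₁⟩ : ∃ x, x = biprod.inl ≫ σ' := ⟨_, rfl⟩
  obtain ⟨p₂, hp₂⟩ : ∃ x, x = biprod.inr ≫ σ' := ⟨_, rfl⟩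
  obtain ⟨s₁, hs₁⟩ : ∃ x, x = s ≫ biprod.fst := ⟨_, rfl⟩
  obtain ⟨s₂, hs₂⟩ : ∃ x, x = s ≫ biprod.snd := ⟨_, rfl⟩
  obtain ⟨t₁, ht₁⟩ : ∃ x, x = t ≫ biprod.fst := ⟨_, rfl⟩
  obtain ⟨t₂, ht₂⟩ : ∃ x, x = t ≫ biprod.snd := ⟨_, rfl⟩
  obtain rfl : σ = biprod.desc σ₁ σ₂ := by ext <;> simp [hσ₁, hσ₂]
  obtain rfl : σ' = biprod.desc p₁ p₂ := by ext <;> simp [hp₁, hp₂]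
  obtain rfl : s = biprod.lift s₁ s₂ := by ext <;> simp [hs₁, hs₂]
  obtain rfl : t = biprod.lift t₁ t₂ := by ext <;> simp [ht₁, ht₂]
  have e1 : τ = s₁ ≫ Y.ρ + s₂ ≫ α + T.γ ≫ t₁ := by
    simpa [biprod.lift_desc] using congrArg (· ≫ biprod.fst) h
  have e2 : 0 = s₂ ≫ X.γ + T.γ ≫ t₂ := by
    simpa [biprod.lift_desc] using congrArg (· ≫ biprod.snd) h
  have e3 : 𝟙 _ = σ₁ ≫ X.ρ + (X.γ ≫ p₁ + α ≫ p₂) := by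
    simpa [biprod.lift_desc] using congrArg (biprod.inl ≫ ·) hσ
  have e4 : 0 = σ₂ ≫ X.ρ + Y.ρ ≫ p₂ := by
    simpa [biprod.lift_desc] using congrArg (biprod.inr ≫ ·) hσ
  have e2' : s₂ ≫ X.γ = -(T.γ ≫ t₂) := (neg_eq_of_add_eq_zero_left e2.symm).symm
  have e3' : α ≫ p₂ = 𝟙 _ - σ₁ ≫ X.ρ - X.γ ≫ p₁ := by rw [e3]; abel
  have e4' : Y.ρ ≫ p₂ = -(σ₂ ≫ X.ρ) := (neg_eq_of_add_eq_zero_right e4.symm).symm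
  have hu : s₂ + T.γ ≫ (t₂ ≫ p₁ + t₁ ≫ p₂) =
      τ ≫ p₂ + (s₁ ≫ σ₂ + s₂ ≫ σ₁) ≫ X.ρ := by
    rw [e1]
    simp only [Preadditive.comp_add, Preadditive.add_comp, Preadditive.comp_sub, Category.assoc,
      Category.comp_id, reassoc_of% e2', e3', e4', Preadditive.neg_comp, Preadditive.comp_neg]
    abel
  refine ⟨homMk (s₂ + T.γ ≫ (t₂ ≫ p₁ + t₁ ≫ p₂))
    (-(ω' ≫ σ₂) + T.ρ ≫ (s₁ ≫ σ₂ + s₂ ≫ σ₁)) (-t₂ + (t₂ ≫ p₁ + t₁ ≫ p₂) ≫ X.γ) ?_ ?_, ?_⟩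
  · rw [hu]
    simp only [Preadditive.comp_add, Preadditive.add_comp, Category.assoc, reassoc_of% h1, e4',
      Preadditive.neg_comp, Preadditive.comp_neg]
  · simp only [Preadditive.comp_add, Preadditive.add_comp, Category.assoc, e2',
      Preadditive.comp_neg]
  · rw [homMk_comp, homMk_eq_iff]
    refine ⟨-s₁, (t₂ ≫ p₁ + t₁ ≫ p₂) ≫ α - t₁, ?_⟩
    rw [e1]
    simp only [Preadditive.comp_add, Preadditive.add_comp, Preadditive.comp_sub, Category.assoc,
      Preadditive.neg_comp]
    abel

end Kernels

/-! ### The Adelman category is abelian -/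

instance : HasKernels (Adel A) where
  has_limit f := by
    obtain ⟨α, ω, ψ, hω, hψ, rfl⟩ := exists_homMk f
    exact ⟨⟨_, kerIsLimit hω hψ⟩⟩

instance : HasCokernels (Adel A) where
  has_colimit f := by
    obtain ⟨α, ω, ψ, hω, hψ, rfl⟩ := exists_homMk f
    exact ⟨⟨_, cokerIsColimit hω hψ⟩⟩

instance : IsNormalEpiCategory (Adel A) where
  normalEpiOfEpi {X Y} f hf := by
    obtain ⟨α, ω, ψ, hω, hψ, rfl⟩ := exists_homMk f
    exact ⟨{ W := _
             g := kerι X Y α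
             w := kerι_comp hω hψ
             isColimit := CokernelCofork.IsColimit.ofπ _ _
              (fun k hk => (epi_desc hω hψ k hk).choose)
              (fun k hk => (epi_desc hω hψ k hk).choose_spec)
              (fun k hk m hm => by
                rw [← cancel_epi (homMk α ω ψ hω hψ), hm, (epi_desc hω hψ k hk).choose_spec]) }⟩

instance : IsNormalMonoCategory (Adel A) where
  normalMonoOfMono {X Y} f hf := by
    obtain ⟨α, ω, ψ, hω, hψ, rfl⟩ := exists_homMk f
    exact ⟨{ Z := _
             g := cokerπ X Y α
             w := comp_cokerπ hω hψ
             isLimit := KernelFork.IsLimit.ofι _ _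
              (fun k hk => (mono_lift hω hψ k hk).choose)
              (fun k hk => (mono_lift hω hψ k hk).choose_spec)
              (fun k hk m hm => by
                rw [← cancel_mono (homMk α ω ψ hω hψ), hm,
                  (mono_lift hω hψ k hk).choose_spec]) }⟩

open ZeroObject

instance : HasZeroObject (Adel A) where
  zero := by
    refine ⟨⟨(0 : (0 : A) ⟶ 0), (0 : (0 : A) ⟶ 0)⟩, (IsZero.iff_id_eq_zero _).2 ?_⟩
    refine (homMk_eq_zero_iff (ω := 𝟙 _) (ψ := 𝟙 _) (by simp) (by simp)).2 ⟨0, 0, ?_⟩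
    exact (isZero_zero A).eq_of_src _ _

instance : HasBinaryBiproducts (Adel A) where
  has_binary_biproduct X Y := by
    refine hasBinaryBiproduct_of_total
      { pt := ⟨biprod.map X.ρ Y.ρ, biprod.map X.γ Y.γ⟩
        fst := homMk biprod.fst biprod.fst biprod.fst (by simp) (by simp)
        snd := homMk biprod.snd biprod.snd biprod.snd (by simp) (by simp)
        inl := homMk biprod.inl biprod.inl biprod.inl (by simp) (by simp)
        inr := homMk biprod.inr biprod.inr biprod.inr (by simp) (by simp)
        inl_fst := by
          rw [homMk_comp]
          exact (homMk_eq_iff (ω' := 𝟙 _) (ψ' := 𝟙 _) _ _ (by simp) (by simp)).2 ⟨0, 0, by simp⟩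
        inl_snd := by
          rw [homMk_comp, homMk_eq_zero_iff]
          exact ⟨0, 0, by simp⟩
        inr_fst := by
          rw [homMk_comp, homMk_eq_zero_iff]
          exact ⟨0, 0, by simp⟩
        inr_snd := by
          rw [homMk_comp]
          exact (homMk_eq_iff (ω' := 𝟙 _) (ψ' := 𝟙 _) _ _ (by simp) (by simp)).2
            ⟨0, 0, by simp⟩ } ?_
    exact (homMk_eq_iff (ω := 𝟙 _) (ψ := 𝟙 _) (ω' := 𝟙 _) (ψ' := 𝟙 _) (α := biprod.fst ≫ biprod.inl +
      biprod.snd ≫ biprod.inr) (by ext <;> simp) (by ext <;> simp) (by simp) (by simp)).2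
      ⟨0, 0, by simp⟩

instance : Abelian (Adel A) where
  has_finite_products := hasFiniteProducts_of_has_binary_and_terminal

/-- The object `(0 → a → 0)`, the image of `a` under the canonical embedding. -/
abbrev emb (a : A) : Adel A := ⟨(0 : (0 : A) ⟶ a), (0 : a ⟶ (0 : A))⟩

/-- The object `(r --ρ--> a → 0)`. -/
abbrev rel {r a : A} (ρ : r ⟶ a) : Adel A := ⟨ρ, (0 : a ⟶ (0 : A))⟩

/-- The object `(0 → a --γ--> c)`. -/
abbrev corel {a c : A} (γ : a ⟶ c) : Adel A := ⟨(0 : (0 : A) ⟶ a), γ⟩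

end

end Adel

/-! ### The category of a quiver with relations -/

section QuiverCategory

/-- The free `ℤ`-linear category on a quiver: morphisms are `ℤ`-linear combinations of paths. -/
abbrev PathCat (Q : Type u) [Quiver.{v} Q] := Free ℤ (Paths Q)

/-- A node of the quiver, as an object of the free `ℤ`-linear category. -/
noncomputable abbrev node {Q : Type u} [Quiver.{v} Q] (x : Q) : PathCat Q :=
  (Free.embedding ℤ (Paths Q)).obj ((Paths.of Q).obj x)

/-- An arrow of the quiver, as a morphism of the free `ℤ`-linear category. -/
noncomputable def arrow {Q : Type u} [Quiver.{v} Q] {x y : Q} (e : x ⟶ y) : node x ⟶ node y :=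
  (Free.embedding ℤ (Paths Q)).map ((Paths.of Q).map e)

variable {C : Type u} [Category.{v} C] [Preadditive C]

/-- The two-sided ideal of a preadditive category generated by a family `R` of morphisms. -/
def idealGen (R : ∀ x y : C, Set (x ⟶ y)) (x y : C) : AddSubgroup (x ⟶ y) :=
  AddSubgroup.closure {f | ∃ (x' y' : C) (p : x ⟶ x') (m : x' ⟶ y') (q : y' ⟶ y),
    m ∈ R x' y' ∧ f = p ≫ m ≫ q}

/-- Equality modulo the ideal generated by `R`. -/
def idealRel (R : ∀ x y : C, Set (x ⟶ y)) : HomRel C := fun x y f g => f - g ∈ idealGen R x y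

variable (R : ∀ x y : C, Set (x ⟶ y))

theorem comp_mem_idealGen {x y z : C} (f : x ⟶ y) {g : y ⟶ z} (hg : g ∈ idealGen R y z) :
    f ≫ g ∈ idealGen R x z := by
  induction hg using AddSubgroup.closure_induction with
  | mem g hg =>
    obtain ⟨x', y', p, m, q, hm, rfl⟩ := hg
    exact AddSubgroup.subset_closure ⟨x', y', f ≫ p, m, q, hm, by simp⟩
  | zero => rw [comp_zero]; exact zero_mem _
  | add a b _ _ ha hb => rw [Preadditive.comp_add]; exact add_mem ha hb
  | neg a _ ha => rw [Preadditive.comp_neg]; exact neg_mem ha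

theorem mem_idealGen_comp {x y z : C} {f : x ⟶ y} (g : y ⟶ z) (hf : f ∈ idealGen R x y) :
    f ≫ g ∈ idealGen R x z := by
  induction hf using AddSubgroup.closure_induction with
  | mem f hf =>
    obtain ⟨x', y', p, m, q, hm, rfl⟩ := hf
    exact AddSubgroup.subset_closure ⟨x', y', p, m, q ≫ g, hm, by simp⟩
  | zero => rw [zero_comp]; exact zero_mem _
  | add a b _ _ ha hb => rw [Preadditive.add_comp]; exact add_mem ha hb
  | neg a _ ha => rw [Preadditive.neg_comp]; exact neg_mem ha

instance : Congruence (idealRel R) where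
  equivalence :=
    { refl f := by simp [idealRel]
      symm {f g} h := by unfold idealRel at *; rw [← neg_sub]; exact neg_mem h
      trans {f g k} h h' := by
        unfold idealRel at *
        rw [← sub_add_sub_cancel f g k]; exact add_mem h h' }
  comp_left f _ _ h := by
    unfold idealRel at *
    rw [← Preadditive.comp_sub]; exact comp_mem_idealGen R f h
  comp_right g h := by
    unfold idealRel at *
    rw [← Preadditive.sub_comp]; exact mem_idealGen_comp R g h

/-- The quotient of a preadditive category by the ideal generated by `R`. For `C = PathCat Q` and
relations `R`, this is the `ℤ`-linear category of the quiver `Q` with relations `R`. -/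
abbrev IdealQuotient := Quotient (idealRel R)

instance : Preadditive (IdealQuotient R) :=
  Quotient.preadditive _ fun _ _ f₁ f₂ g₁ g₂ hf hg => by
    unfold idealRel at *
    rw [add_sub_add_comm]; exact add_mem hf hg

instance : (Quotient.functor (idealRel R)).Additive := Quotient.functor_additive _ _

theorem IdealQuotient.map_eq_zero {x y : C} {f : x ⟶ y} (hf : f ∈ R x y) :
    (Quotient.functor (idealRel R)).map f = 0 := by
  rw [← Functor.map_zero (Quotient.functor (idealRel R)) x y]
  apply CategoryTheory.Quotient.sound
  unfold idealRel
  rw [sub_zero]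
  exact AddSubgroup.subset_closure ⟨x, y, 𝟙 _, f, 𝟙 _, hf, by simp⟩

end QuiverCategory

/-! ### The refined 5-lemma -/

section Homology

variable {𝓑 : Type u} [Category.{v} 𝓑] [Abelian 𝓑]

/-- The homology `ker β / (im α ∩ ker β)` of a composable pair, with no condition on `α ≫ β`:
the image of `ker β → b → coker α`. -/
noncomputable abbrev pairHomology {a b c : 𝓑} (α : a ⟶ b) (β : b ⟶ c) : 𝓑 :=
  image (kernel.ι β ≫ cokernel.π α)

/-- Functoriality of the homology of composable pairs. -/
noncomputable def pairHomologyMap {a b c a' b' c' : 𝓑} {α : a ⟶ b} {β : b ⟶ c}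
    {α' : a' ⟶ b'} {β' : b' ⟶ c'} (p : a ⟶ a') (q : b ⟶ b') (r : c ⟶ c')
    (h₁ : α ≫ q = p ≫ α') (h₂ : β ≫ r = q ≫ β') : pairHomology α β ⟶ pairHomology α' β' :=
  image.map (Arrow.homMk (f := Arrow.mk (kernel.ι β ≫ cokernel.π α))
    (g := Arrow.mk (kernel.ι β' ≫ cokernel.π α'))
    (kernel.map β β' q r h₂) (cokernel.map α α' p q h₁) (by simp))

/-- `Y` is a subquotient of `X`: a quotient of a subobject of `X`. -/
def IsSubquotient (Y X : 𝓑) : Prop :=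
  ∃ (S : 𝓑) (i : S ⟶ X) (p : S ⟶ Y), Mono i ∧ Epi p

end Homology

/-- A (not necessarily commutative) diagram of the shape of the 5-lemma. -/
structure FiveDiagram (𝓑 : Type u) [Category.{v} 𝓑] where
  {a : 𝓑}
  {b : 𝓑}
  {c : 𝓑}
  {d : 𝓑}
  {e : 𝓑}
  {f : 𝓑}
  {g : 𝓑}
  {h : 𝓑}
  α : a ⟶ b
  β : b ⟶ c
  γ : c ⟶ d
  δ : a ⟶ e
  ε : b ⟶ f
  ζ : c ⟶ g
  η : d ⟶ h
  θ : e ⟶ f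
  ι : f ⟶ g
  κ : g ⟶ h

namespace FiveDiagram

variable {𝓑 : Type u} [Category.{v} 𝓑] [Abelian 𝓑] (D : FiveDiagram 𝓑)

/-- The premise of the refined 5-lemma. -/
structure Premise : Prop where
  comm₁ : D.α ≫ D.ε = D.δ ≫ D.θ
  comm₂ : D.β ≫ D.ζ = D.ε ≫ D.ι
  comm₃ : D.γ ≫ D.η = D.ζ ≫ D.κ
  zero₁ : D.α ≫ D.β = 0
  zero₂ : D.β ≫ D.γ = 0
  zero₃ : D.θ ≫ D.ι = 0
  zero₄ : D.ι ≫ D.κ = 0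
  epi_δ : Epi D.δ
  mono_η : Mono D.η

variable {D}

noncomputable section

/-- The induced morphism `ker ε → ker ζ`. -/
def kerMap (P : D.Premise) : kernel D.ε ⟶ kernel D.ζ := kernel.map D.ε D.ζ D.β D.ι P.comm₂.symm

theorem kernel_ι_comp_γ (P : D.Premise) : kernel.ι D.ζ ≫ D.γ = 0 := by
  have := P.mono_η
  rw [← cancel_mono D.η, Category.assoc, P.comm₃, kernel.condition_assoc, zero_comp, zero_comp]

/-- The induced morphism `ker ζ → H(β, γ)`, which exists since `ker ζ ≤ ker γ`. -/
def kerToHomology (P : D.Premise) : kernel D.ζ ⟶ pairHomology D.β D.γ :=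
  kernel.lift D.γ (kernel.ι D.ζ) (kernel_ι_comp_γ P) ≫
    factorThruImage (kernel.ι D.γ ≫ cokernel.π D.β)

/-- `H(ker ε → ker ζ → H(β, γ))`. -/
abbrev source (P : D.Premise) : 𝓑 := pairHomology (kerMap P) (kerToHomology P)

/-- The morphism `H(ε) : H(α, β) → H(θ, ι)`. -/
def homologyMap (P : D.Premise) : pairHomology D.α D.β ⟶ pairHomology D.θ D.ι :=
  pairHomologyMap D.δ D.ε D.ζ P.comm₁ P.comm₂

/-- `coker (H(ε) : H(α, β) → H(θ, ι))`. -/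
abbrev target (P : D.Premise) : 𝓑 := cokernel (homologyMap P)

/-- The conclusion of the refined 5-lemma. -/
structure Conclusion (P : D.Premise) : Prop where
  exists_mono : ∃ m : source P ⟶ target P, Mono m
  /-- a filtration `0 ≤ F₁ ≤ F₂ ≤ ker ζ` whose graded parts are subquotients of `ker ε`,
  `H(θ, ι)` and `H(β, γ)` -/
  filtration : ∃ (F₁ F₂ : Subobject (kernel D.ζ)) (h : F₁ ≤ F₂),
    IsSubquotient (F₁ : 𝓑) (kernel D.ε) ∧
    IsSubquotient (cokernel (F₁.ofLE F₂ h)) (pairHomology D.θ D.ι) ∧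
    IsSubquotient (cokernel F₂.arrow) (pairHomology D.β D.γ)
  mono_ζ : IsZero (kernel D.ε) → IsZero (pairHomology D.β D.γ) → IsZero (pairHomology D.θ D.ι) →
    Mono D.ζ

end

end FiveDiagram

/-! ### The universal instance -/

namespace UniversalFive

noncomputable section

/-- The nodes of the quiver. -/
inductive Node
  | i | a | b | c | f | g | h | j

/-- The arrows of the quiver. -/
inductive Arr : Node → Node → Type
  | lam : Arr .i .a
  | alpha : Arr .a .b
  | beta : Arr .b .c
  | eps : Arr .b .f
  | zeta : Arr .c .g
  | iota : Arr .f .g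
  | kappa : Arr .g .h
  | mu : Arr .h .j

instance : Quiver Node := ⟨Arr⟩

/-- The relations. -/
inductive Rels : ∀ x y : PathCat Node, (x ⟶ y) → Prop
  | alpha_beta : Rels _ _ (arrow Arr.alpha ≫ arrow Arr.beta)
  | iota_kappa : Rels _ _ (arrow Arr.iota ≫ arrow Arr.kappa)
  | beta_zeta : Rels _ _ (arrow Arr.beta ≫ arrow Arr.zeta - arrow Arr.eps ≫ arrow Arr.iota)
  | lam_alpha_eps : Rels _ _ (arrow Arr.lam ≫ arrow Arr.alpha ≫ arrow Arr.eps)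
  | zeta_kappa_mu : Rels _ _ (arrow Arr.zeta ≫ arrow Arr.kappa ≫ arrow Arr.mu)

/-- The category of the quiver with relations. -/
abbrev CQR := IdealQuotient (C := PathCat Node) (fun x y => {m | Rels x y m})

/-- Its additive closure: objects are finite tuples, morphisms are matrices. -/
abbrev CQRplus := Mat_ CQR

/-- A node as an object. -/
abbrev ob (x : Node) : CQR := (Quotient.functor _).obj (node x)

/-- An arrow as a morphism. -/
def ar {x y : Node} (e : Arr x y) : ob x ⟶ ob y := (Quotient.functor _).map (arrow (Q := Node) e)

/-- A node as a one-entry tuple. -/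
abbrev sg (x : Node) : CQRplus := (Mat_.embedding CQR).obj (ob x)

/-- An arrow as a one-by-one matrix. -/
abbrev sgm {x y : Node} (e : Arr x y) : sg x ⟶ sg y := (Mat_.embedding CQR).map (ar e)

open Arr

theorem ar_alpha_beta : ar alpha ≫ ar beta = 0 := by
  unfold ar
  rw [← Functor.map_comp]
  exact IdealQuotient.map_eq_zero _ Rels.alpha_beta

theorem ar_iota_kappa : ar iota ≫ ar kappa = 0 := by
  unfold ar
  rw [← Functor.map_comp]
  exact IdealQuotient.map_eq_zero _ Rels.iota_kappa

theorem ar_beta_zeta : ar beta ≫ ar zeta = ar eps ≫ ar iota := by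
  unfold ar
  rw [← sub_eq_zero, ← Functor.map_comp, ← Functor.map_comp, ← Functor.map_sub]
  exact IdealQuotient.map_eq_zero _ Rels.beta_zeta

theorem ar_lam_alpha_eps : ar lam ≫ ar alpha ≫ ar eps = 0 := by
  unfold ar
  rw [← Functor.map_comp, ← Functor.map_comp]
  exact IdealQuotient.map_eq_zero _ Rels.lam_alpha_eps

theorem ar_zeta_kappa_mu : ar zeta ≫ ar kappa ≫ ar mu = 0 := by
  unfold ar
  rw [← Functor.map_comp, ← Functor.map_comp]
  exact IdealQuotient.map_eq_zero _ Rels.zeta_kappa_mu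

theorem sgm_lam_alpha_eps : sgm lam ≫ sgm alpha ≫ sgm eps = 0 := by
  rw [← Functor.map_comp, ← Functor.map_comp, ar_lam_alpha_eps, Functor.map_zero]

theorem sgm_zeta_kappa_mu : sgm zeta ≫ sgm kappa ≫ sgm mu = 0 := by
  rw [← Functor.map_comp, ← Functor.map_comp, ar_zeta_kappa_mu, Functor.map_zero]

open Adel

/-- The diagram in the Adelman category. -/
abbrev diagram : FiveDiagram (Adel CQRplus) where
  a := emb (sg .a)
  b := emb (sg .b)
  c := emb (sg .c)
  d := corel (sgm mu)
  e := rel (sgm lam)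
  f := emb (sg .f)
  g := emb (sg .g)
  h := emb (sg .h)
  α := homMk (sgm alpha) 0 0 (by simp) (by simp)
  β := homMk (sgm beta) 0 0 (by simp) (by simp)
  γ := homMk (sgm zeta ≫ sgm kappa) 0 0 (by simp)
    (by simpa using sgm_zeta_kappa_mu)
  δ := homMk (𝟙 (sg .a)) 0 0 (by simp) (by simp)
  ε := homMk (sgm eps) 0 0 (by simp) (by simp)
  ζ := homMk (sgm zeta) 0 0 (by simp) (by simp)
  η := homMk (𝟙 (sg .h)) 0 0 (by simp) (by simp)
  θ := homMk (sgm alpha ≫ sgm eps) 0 0 (by simpa using sgm_lam_alpha_eps) (by simp)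
  ι := homMk (sgm iota) 0 0 (by simp) (by simp)
  κ := homMk (sgm kappa) 0 0 (by simp) (by simp)

/-- A tuple of nodes `x₁ ⊕ ... ⊕ xₙ`, as an object of the additive closure. -/
abbrev tup {n : ℕ} (x : Fin n → Node) : CQRplus := ⟨Fin n, fun k => ob (x k)⟩

open Node

/-- Rows of a matrix from `X` to `y₁ ⊕ ... ⊕ yₙ`. -/
abbrev Row (X : CQR) {n : ℕ} (y : Fin n → Node) : Type := ∀ l, X ⟶ ob (y l)

/-- The empty row. -/
def emptyRow {X : CQR} : Row X ![] := fun l => l.elim0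

/-- The row with first entry `f` and remaining entries `r`. -/
def consRow {X : CQR} {x : Node} {n : ℕ} {y : Fin n → Node} (f : X ⟶ ob x) (r : Row X y) :
    Row X (Matrix.vecCons x y) :=
  fun l => Fin.cases (motive := fun l => X ⟶ ob (Matrix.vecCons x y l)) f r l

/-- The matrix without rows. -/
def noRows {n : ℕ} {y : Fin n → Node} (k : Fin 0) : Row (ob ((![] : Fin 0 → Node) k)) y := k.elim0

/-- The matrix with first row `r` and remaining rows `M`. -/
def consMat {x : Node} {m n : ℕ} {x' : Fin m → Node} {y : Fin n → Node} (r : Row (ob x) y)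
    (M : ∀ k, Row (ob (x' k)) y) : ∀ k, Row (ob (Matrix.vecCons x x' k)) y :=
  fun k => Fin.cases (motive := fun k => Row (ob (Matrix.vecCons x x' k)) y) r M k

/-- The morphism of tuples with the given rows: the `l`-th entry of the `k`-th row is the component
from the `k`-th summand of the source to the `l`-th summand of the target. -/
def ofRows {m n : ℕ} {x : Fin m → Node} {y : Fin n → Node} (M : ∀ k, Row (ob (x k)) y) :
    tup x ⟶ tup y := M

infixr:67 " ∷ " => consRow

infixr:66 " ∷∷ " => consMat

section MatrixMultiplication

variable {X Y : CQR} {x : Node} {m n p : ℕ} {x' : Fin m → Node} {y : Fin n → Node}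
  {z : Fin p → Node}

/-- Sum of rows. -/
def addRow (r r' : Row X y) : Row X y := fun l => r l + r' l

/-- Multiple of a row. -/
def smulRow (f : Y ⟶ X) (r : Row X y) : Row Y y := fun l => f ≫ r l

/-- Row times matrix. -/
def rowMul (r : Row X y) (N : ∀ k, Row (ob (y k)) z) : Row X z := fun l => ∑ k, r k ≫ N k l

/-- Matrix times matrix. -/
def matMul (M : ∀ k, Row (ob (x' k)) y) (N : ∀ k, Row (ob (y k)) z) : ∀ k, Row (ob (x' k)) z :=
  fun k => rowMul (M k) N

theorem ofRows_comp (M : ∀ k, Row (ob (x' k)) y) (N : ∀ k, Row (ob (y k)) z) :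
    ofRows M ≫ ofRows N = ofRows (matMul M N) := rfl

theorem matMul_cons (r : Row (ob x) y) (M : ∀ k, Row (ob (x' k)) y)
    (N : ∀ k, Row (ob (y k)) z) : matMul (r ∷∷ M) N = rowMul r N ∷∷ matMul M N := by
  funext k
  induction k using Fin.cases <;> rfl

theorem matMul_nil (N : ∀ k, Row (ob (y k)) z) : matMul noRows N = noRows := by
  funext k
  exact k.elim0

theorem rowMul_cons (f : X ⟶ ob x) (r : Row X y) (s : Row (ob x) z) (N : ∀ k, Row (ob (y k)) z) :
    rowMul (f ∷ r) (s ∷∷ N) = addRow (smulRow f s) (rowMul r N) := by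
  funext l
  exact Fin.sum_univ_succ _

theorem addRow_rowMul_nil (r : Row X z) : addRow r (rowMul emptyRow noRows) = r := by
  funext l
  exact (congrArg (r l + ·) Finset.sum_empty).trans (add_zero _)

theorem smulRow_cons (f : Y ⟶ X) (g : X ⟶ ob x) (r : Row X y) :
    smulRow f (g ∷ r) = (f ≫ g) ∷ smulRow f r := by
  funext k
  induction k using Fin.cases <;> rfl

theorem smulRow_nil (f : Y ⟶ X) : smulRow f emptyRow = emptyRow := by
  funext k
  exact k.elim0

theorem addRow_cons (f g : X ⟶ ob x) (r s : Row X y) :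
    addRow (f ∷ r) (g ∷ s) = (f + g) ∷ addRow r s := by
  funext k
  induction k using Fin.cases <;> rfl

theorem addRow_nil : addRow (emptyRow : Row X ![]) emptyRow = emptyRow := by
  funext k
  exact k.elim0

end MatrixMultiplication

/-- The relation morphism of `sourceObj`. -/
def sourceρ : tup ![b, b] ⟶ tup ![c, f, b] := ofRows (
  (ar beta ∷ ar eps ∷ 0 ∷ emptyRow) ∷∷
  (0 ∷ 0 ∷ 𝟙 _ ∷ emptyRow) ∷∷ noRows)

/-- The corelation morphism of `sourceObj`. -/
def sourceγ : tup ![c, f, b] ⟶ tup ![g, f, c] := ofRows (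
  (ar zeta ∷ 0 ∷ 𝟙 _ ∷ emptyRow) ∷∷
  (0 ∷ 𝟙 _ ∷ 0 ∷ emptyRow) ∷∷
  (0 ∷ 0 ∷ ar beta ∷ emptyRow) ∷∷ noRows)

/-- `(b⊕b → c⊕f⊕b → g⊕f⊕c)`: the source of the explicit monomorphism. -/
abbrev sourceObj : Adel CQRplus := ⟨sourceρ, sourceγ⟩

/-- The relation morphism of `targetObj`. -/
def targetρ : tup ![a, b] ⟶ tup ![f, c] := ofRows (
  (ar alpha ≫ ar eps ∷ 0 ∷ emptyRow) ∷∷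
  (ar eps ∷ ar beta ∷ emptyRow) ∷∷ noRows)

/-- The corelation morphism of `targetObj`. -/
def targetγ : tup ![f, c] ⟶ tup ![g, c] := ofRows (
  (ar iota ∷ 0 ∷ emptyRow) ∷∷
  (0 ∷ 𝟙 _ ∷ emptyRow) ∷∷ noRows)

/-- `(a⊕b → f⊕c → g⊕c)`: the target of the explicit monomorphism. -/
abbrev targetObj : Adel CQRplus := ⟨targetρ, targetγ⟩

/-- The morphism datum of the explicit monomorphism. -/
def datum : tup ![c, f, b] ⟶ tup ![f, c] := ofRows (
  (0 ∷ 𝟙 _ ∷ emptyRow) ∷∷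
  (𝟙 _ ∷ 0 ∷ emptyRow) ∷∷
  (ar eps ∷ ar beta ∷ emptyRow) ∷∷ noRows)

/-- Its relation witness. -/
def datumω : tup ![b, b] ⟶ tup ![a, b] := ofRows (
  (0 ∷ 𝟙 _ ∷ emptyRow) ∷∷
  (0 ∷ 𝟙 _ ∷ emptyRow) ∷∷ noRows)

/-- Its corelation witness. -/
def datumψ : tup ![g, f, c] ⟶ tup ![g, c] := ofRows (
  ((-𝟙 _) ∷ 0 ∷ emptyRow) ∷∷
  (ar iota ∷ 0 ∷ emptyRow) ∷∷
  (ar zeta ∷ 𝟙 _ ∷ emptyRow) ∷∷ noRows)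

theorem datum_relation : sourceρ ≫ datum = datumω ≫ targetρ := by
  unfold sourceρ datum datumω targetρ
  simp only [ofRows_comp, matMul_cons, matMul_nil, rowMul_cons, addRow_rowMul_nil, smulRow_cons,
    smulRow_nil, addRow_cons, addRow_nil]
  simp

theorem datum_corelation : datum ≫ targetγ = sourceγ ≫ datumψ := by
  unfold datum targetγ sourceγ datumψ
  simp only [ofRows_comp, matMul_cons, matMul_nil, rowMul_cons, addRow_rowMul_nil, smulRow_cons,
    smulRow_nil, addRow_cons, addRow_nil]
  simp [ar_beta_zeta]

/-- The explicit monomorphism `{datumω, datum, datumψ}`. -/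
def explicitMono : sourceObj ⟶ targetObj :=
  homMk datum datumω datumψ datum_relation datum_corelation

/-- The relation morphism of `kernelObj`. -/
def kernelρ : tup ![b, b, a, b] ⟶ tup ![c, f, b, a, b] := ofRows (
  (ar beta ∷ ar eps ∷ 0 ∷ 0 ∷ 0 ∷ emptyRow) ∷∷
  (0 ∷ 0 ∷ 𝟙 _ ∷ 0 ∷ 0 ∷ emptyRow) ∷∷
  (0 ∷ 0 ∷ 0 ∷ 𝟙 _ ∷ 0 ∷ emptyRow) ∷∷
  (0 ∷ 0 ∷ 0 ∷ 0 ∷ 𝟙 _ ∷ emptyRow) ∷∷ noRows)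

/-- The corelation morphism of `kernelObj`. -/
def kernelγ : tup ![c, f, b, a, b] ⟶ tup ![g, f, c, f, c] := ofRows (
  (ar zeta ∷ 0 ∷ 𝟙 _ ∷ 0 ∷ 𝟙 _ ∷ emptyRow) ∷∷
  (0 ∷ 𝟙 _ ∷ 0 ∷ 𝟙 _ ∷ 0 ∷ emptyRow) ∷∷
  (0 ∷ 0 ∷ ar beta ∷ ar eps ∷ ar beta ∷ emptyRow) ∷∷
  (0 ∷ 0 ∷ 0 ∷ ar alpha ≫ ar eps ∷ 0 ∷ emptyRow) ∷∷
  (0 ∷ 0 ∷ 0 ∷ ar eps ∷ ar beta ∷ emptyRow) ∷∷ noRows)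

/-- `(b⊕b⊕a⊕b → c⊕f⊕b⊕a⊕b → g⊕f⊕c⊕f⊕c)`: the kernel object of the explicit monomorphism. -/
abbrev kernelObj : Adel CQRplus := ⟨kernelρ, kernelγ⟩

/-- Projection of `b⊕b⊕a⊕b` to its first two summands. -/
def projRel : tup ![b, b, a, b] ⟶ tup ![b, b] := ofRows (
  (𝟙 _ ∷ 0 ∷ emptyRow) ∷∷
  (0 ∷ 𝟙 _ ∷ emptyRow) ∷∷
  (0 ∷ 0 ∷ emptyRow) ∷∷
  (0 ∷ 0 ∷ emptyRow) ∷∷ noRows)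

/-- Projection of `c⊕f⊕b⊕a⊕b` to its first three summands. -/
def projMid : tup ![c, f, b, a, b] ⟶ tup ![c, f, b] := ofRows (
  (𝟙 _ ∷ 0 ∷ 0 ∷ emptyRow) ∷∷
  (0 ∷ 𝟙 _ ∷ 0 ∷ emptyRow) ∷∷
  (0 ∷ 0 ∷ 𝟙 _ ∷ emptyRow) ∷∷
  (0 ∷ 0 ∷ 0 ∷ emptyRow) ∷∷
  (0 ∷ 0 ∷ 0 ∷ emptyRow) ∷∷ noRows)

/-- Projection of `g⊕f⊕c⊕f⊕c` to its first three summands. -/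
def projCorel : tup ![g, f, c, f, c] ⟶ tup ![g, f, c] := ofRows (
  (𝟙 _ ∷ 0 ∷ 0 ∷ emptyRow) ∷∷
  (0 ∷ 𝟙 _ ∷ 0 ∷ emptyRow) ∷∷
  (0 ∷ 0 ∷ 𝟙 _ ∷ emptyRow) ∷∷
  (0 ∷ 0 ∷ 0 ∷ emptyRow) ∷∷
  (0 ∷ 0 ∷ 0 ∷ emptyRow) ∷∷ noRows)

theorem proj_relation : kernelρ ≫ projMid = projRel ≫ sourceρ := by
  unfold kernelρ projMid projRel sourceρ
  simp only [ofRows_comp, matMul_cons, matMul_nil, rowMul_cons, addRow_rowMul_nil, smulRow_cons,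
    smulRow_nil, addRow_cons, addRow_nil]
  simp

theorem proj_corelation : projMid ≫ sourceγ = kernelγ ≫ projCorel := by
  unfold projMid sourceγ kernelγ projCorel
  simp only [ofRows_comp, matMul_cons, matMul_nil, rowMul_cons, addRow_rowMul_nil, smulRow_cons,
    smulRow_nil, addRow_cons, addRow_nil]
  simp

/-- The kernel embedding of the explicit monomorphism. -/
def kernelEmb : kernelObj ⟶ sourceObj :=
  homMk projMid projRel projCorel proj_relation proj_corelation

/-- First member of the witness pair. -/
def witness₁ : tup ![c, f, b, a, b] ⟶ tup ![b, b, a, b] := ofRows (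
  (0 ∷ 0 ∷ 0 ∷ 0 ∷ emptyRow) ∷∷
  (0 ∷ 0 ∷ 0 ∷ 0 ∷ emptyRow) ∷∷
  ((-𝟙 _) ∷ 𝟙 _ ∷ 0 ∷ 0 ∷ emptyRow) ∷∷
  ((-ar alpha) ∷ 0 ∷ 𝟙 _ ∷ 0 ∷ emptyRow) ∷∷
  ((-𝟙 _) ∷ 0 ∷ 0 ∷ 𝟙 _ ∷ emptyRow) ∷∷ noRows)

/-- Second member of the witness pair. -/
def witness₂ : tup ![g, f, c, f, c] ⟶ tup ![c, f, b, a, b] := ofRows (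
  (0 ∷ 0 ∷ 0 ∷ 0 ∷ 0 ∷ emptyRow) ∷∷
  (0 ∷ 0 ∷ 0 ∷ 0 ∷ 0 ∷ emptyRow) ∷∷
  (0 ∷ 0 ∷ 0 ∷ 0 ∷ 0 ∷ emptyRow) ∷∷
  (0 ∷ 𝟙 _ ∷ 0 ∷ 0 ∷ 0 ∷ emptyRow) ∷∷
  (𝟙 _ ∷ 0 ∷ 0 ∷ 0 ∷ 0 ∷ emptyRow) ∷∷ noRows)

end

end UniversalFive

/-! In an abelian category the whole conclusion of the refined 5-lemma follows from one monomorphism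
from the source into the target (`Conclusion.of_mono`). With F₁ the image of ker ε → ker ζ and F₂
the kernel of ker ζ → H(β, γ), the source is F₂/F₁. The target is a quotient of H(θ, ι), so the
monomorphism makes F₂/F₁ a subquotient of H(θ, ι), while F₁ is a quotient of ker ε and ker ζ/F₂
embeds into H(β, γ).

For the universal diagram the monomorphism can be written down, because in the Adelman category
kernels, cokernels and vanishing are matters of matrices. The kernel of a morphism f : a → b of
embedded objects is (0 → a → b) and its cokernel is (a → b → 0), so source and target can be
computed. The source is the image of a morphism from a kernel object to a cokernel object; X glues
the two, and `toSource`, `fromSource` form the epi-mono factorization. The target is the cokernel of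
a ⊕ ker β → ker ι, which Y represents through `toTarget`.

A morphism of the Adelman category is mono as soon as certain matrix identities hold (`mono_homMk`,
with dual `epi_homMk`). For m these identities come from blocks of the witness pair for id_K = 0,
and αβ = 0 is the only relation of the quiver they need. The object K is then zero, and a zero
object is a kernel of any monomorphism. -/

/-! ### Homology of composable pairs and subquotients in an abelian category -/

section Homology

variable {𝓑 : Type u} [Category.{v} 𝓑] [Abelian 𝓑]

/-- The homology of a composable pair, computed from a kernel `k` of the second morphism, a
cokernel `q` of the first one and an epi-mono factorization of `k ≫ q`. -/
theorem nonempty_pairHomology_iso {a b c K C X : 𝓑} {α : a ⟶ b} {β : b ⟶ c}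
    (k : K ⟶ b) [Mono k] (hk : k ≫ β = 0)
    (hk' : ∀ {T : 𝓑} (t : T ⟶ b), t ≫ β = 0 → ∃ l, l ≫ k = t)
    (q : b ⟶ C) [Epi q] (hq : α ≫ q = 0)
    (hq' : ∀ {T : 𝓑} (t : b ⟶ T), α ≫ t = 0 → ∃ l, q ≫ l = t)
    (e : K ⟶ X) [Epi e] (m : X ⟶ C) [Mono m] (h : k ≫ q = e ≫ m) :
    Nonempty (pairHomology α β ≅ X) := by
  obtain ⟨l, hl⟩ := hk' (kernel.ι β) (kernel.condition β)
  obtain ⟨d, hd⟩ := hq' (cokernel.π α) (cokernel.condition α)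
  have : IsIso l := ⟨kernel.lift β k hk,
    by rw [← cancel_mono (kernel.ι β)]; simp [hl], by rw [← cancel_mono k]; simp [hl]⟩
  have : IsIso d := ⟨cokernel.desc α q hq,
    by rw [← cancel_epi q]; simp [reassoc_of% hd], by rw [← cancel_epi (cokernel.π α)]; simp [hd]⟩
  -- `l` and `d` compare the given kernel and cokernel with the standard ones. Composing the given
  -- factorization with them yields an epi-mono factorization of ker β → coker α, and such
  -- factorizations are unique up to isomorphism.
  have : StrongEpi (l ≫ e) := strongEpi_of_epi _
  exact ⟨(image.isoStrongEpiMono (l ≫ e) (m ≫ d)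
    (by rw [← hl, ← hd]; simp [reassoc_of% h])).symm⟩

/-- Since ker β maps onto the homology, this square determines the induced morphism; it reduces
questions about the cokernel of H(ε) to morphisms between kernels. -/
theorem factorThruImage_pairHomologyMap {a b c a' b' c' : 𝓑} {α : a ⟶ b} {β : b ⟶ c}
    {α' : a' ⟶ b'} {β' : b' ⟶ c'} (p : a ⟶ a') (q : b ⟶ b') (r : c ⟶ c')
    (h₁ : α ≫ q = p ≫ α') (h₂ : β ≫ r = q ≫ β') :
    factorThruImage (kernel.ι β ≫ cokernel.π α) ≫ pairHomologyMap p q r h₁ h₂ =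
      kernel.map β β' q r h₂ ≫ factorThruImage (kernel.ι β' ≫ cokernel.π α') := by
  rw [← cancel_mono (image.ι _)]
  unfold pairHomologyMap
  simp only [Category.assoc]
  erw [image.map_ι]
  simp [image.fac_assoc]

/-- A subobject of a quotient is a subquotient. -/
theorem IsSubquotient.of_mono_of_epi {X Y Z : 𝓑} (m : X ⟶ Y) [Mono m] (p : Z ⟶ Y) [Epi p] :
    IsSubquotient X Z :=
  ⟨pullback m p, pullback.snd m p, pullback.fst m p, inferInstance, inferInstance⟩

/-- Any two kernels of a morphism are isomorphic. -/
theorem exists_iso_kernel {K X Y : 𝓑} {f : X ⟶ Y} {j : K ⟶ X} {h : j ≫ f = 0}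
    (hj : IsLimit (KernelFork.ofι j h)) : ∃ φ : K ≅ kernel f, φ.hom ≫ kernel.ι f = j :=
  ⟨hj.conePointUniqueUpToIso (limit.isLimit _),
    hj.conePointUniqueUpToIso_hom_comp (limit.isLimit _) WalkingParallelPair.zero⟩

end Homology

/-! ### The refined 5-lemma from a monomorphism; computing its source and target -/

namespace FiveDiagram

variable {𝓑 : Type u} [Category.{v} 𝓑] [Abelian 𝓑] {D : FiveDiagram 𝓑}

theorem kerToHomology_comp_image_ι (P : D.Premise) :
    kerToHomology P ≫ image.ι (kernel.ι D.γ ≫ cokernel.π D.β) =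
      kernel.ι D.ζ ≫ cokernel.π D.β := by
  simp [kerToHomology]

/-- H(β, γ) embeds into coker β, so the kernel of ker ζ → H(β, γ) is that of ker ζ → c → coker β.
This is why γ leaves no trace in the explicit source. -/
theorem comp_kerToHomology_eq_zero_iff (P : D.Premise) {T : 𝓑} (t : T ⟶ kernel D.ζ) :
    t ≫ kerToHomology P = 0 ↔ t ≫ kernel.ι D.ζ ≫ cokernel.π D.β = 0 := by
  rw [← cancel_mono (image.ι (kernel.ι D.γ ≫ cokernel.π D.β)), Category.assoc,
    kerToHomology_comp_image_ι, zero_comp]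

theorem kerMap_comp_kerToHomology (P : D.Premise) : kerMap P ≫ kerToHomology P = 0 := by
  rw [comp_kerToHomology_eq_zero_iff]
  simp [kerMap]

/-- The refined 5-lemma, given the monomorphism from which the rest follows. -/
theorem Conclusion.of_mono (P : D.Premise) (m : source P ⟶ target P) [Mono m] :
    Conclusion P where
  exists_mono := ⟨m, inferInstance⟩
  filtration := by
    have h : imageSubobject (kerMap P) ≤ kernelSubobject (kerToHomology P) :=
      image_le_kernel _ _ (kerMap_comp_kerToHomology P)
    refine ⟨imageSubobject (kerMap P), kernelSubobject (kerToHomology P), h, ?_, ?_, ?_⟩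
    · exact ⟨_, 𝟙 _, factorThruImageSubobject (kerMap P), inferInstance, inferInstance⟩
    · have hw : Subobject.ofLE _ _ h ≫ (kernelSubobject (kerToHomology P)).arrow ≫
          cokernel.π (kerMap P) = 0 := by
        rw [Subobject.ofLE_arrow_assoc, ← cancel_epi (factorThruImageSubobject (kerMap P))]
        simp
      -- F₂/F₁ embeds into coker(ker ε → ker ζ): an element of F₂ that vanishes there comes locally
      -- from ker ε, hence from F₁. So F₂ → F₂/F₁ → coker(ker ε → ker ζ) is the epi-mono
      -- factorization whose middle term is the source.
      have : Mono (cokernel.desc _ _ hw) := by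
        refine (ShortComplex.mk _ _ hw).exact_iff_mono_cokernel_desc.1 ?_
        rw [ShortComplex.exact_iff_exact_up_to_refinements]
        intro A x hx
        obtain ⟨A', π, _, y, hy⟩ := (ShortComplex.exact_cokernel (kerMap P)).exact_up_to_refinements
          (x ≫ (kernelSubobject (kerToHomology P)).arrow) (by simpa using hx)
        refine ⟨A', π, inferInstance, y ≫ factorThruImageSubobject (kerMap P), ?_⟩
        rw [← cancel_mono (kernelSubobject (kerToHomology P)).arrow]
        simpa using hy
      obtain ⟨i⟩ := nonempty_pairHomology_iso (α := kerMap P) (β := kerToHomology P)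
        (kernelSubobject (kerToHomology P)).arrow (by simp)
        (fun t ht => ⟨factorThruKernelSubobject _ t ht, by simp⟩)
        (cokernel.π (kerMap P)) (by simp) (fun t ht => ⟨cokernel.desc _ t ht, by simp⟩)
        (cokernel.π (Subobject.ofLE _ _ h)) (cokernel.desc _ _ hw) (by simp)
      -- The pullback of `m` along H(θ, ι) → target is a subobject of H(θ, ι) mapping onto the
      -- source.
      obtain ⟨S, j, p, hj, hp⟩ := IsSubquotient.of_mono_of_epi m (cokernel.π (homologyMap P))
      exact ⟨S, j, p ≫ i.hom, hj, epi_comp _ _⟩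
    · refine ⟨_, cokernel.desc _ (kerToHomology P) (by simp), 𝟙 _, ?_, inferInstance⟩
      refine (ShortComplex.mk _ _ (kernelSubobject_arrow_comp
        (kerToHomology P))).exact_iff_mono_cokernel_desc.1 ?_
      rw [ShortComplex.exact_iff_exact_up_to_refinements]
      exact fun A x hx => ⟨A, 𝟙 _, inferInstance, factorThruKernelSubobject _ x hx, by simp⟩
  mono_ζ hε hβγ hθι := by
    have ht : IsZero (target P) := hθι.of_epi (cokernel.π (homologyMap P))
    have hs : IsZero (source P) := ht.of_mono m
    have h0 : kernel.ι (kerToHomology P) ≫ cokernel.π (kerMap P) = 0 := by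
      rw [← image.fac (kernel.ι (kerToHomology P) ≫ cokernel.π (kerMap P)),
        hs.eq_of_tgt (factorThruImage _) 0, zero_comp]
    -- Both ker ζ → H(β, γ) and ker ε → ker ζ are zero, so the kernel inclusion and the cokernel
    -- projection split. The identity of ker ζ then factors through their composite, which vanishes
    -- because its image, the source, is zero.
    obtain ⟨l, hl⟩ : ∃ l, l ≫ kernel.ι (kerToHomology P) = 𝟙 _ :=
      ⟨kernel.lift _ (𝟙 _) (hβγ.eq_of_tgt _ _), by simp⟩
    obtain ⟨r, hr⟩ : ∃ r, cokernel.π (kerMap P) ≫ r = 𝟙 _ :=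
      ⟨cokernel.desc _ (𝟙 _) (hε.eq_of_src _ _), by simp⟩
    have : 𝟙 (kernel D.ζ) = 0 := by
      calc 𝟙 _ = l ≫ (kernel.ι (kerToHomology P) ≫ cokernel.π (kerMap P)) ≫ r := by
            rw [Category.assoc, hr, Category.comp_id, hl]
        _ = 0 := by rw [h0]; simp
    exact Preadditive.mono_of_kernel_zero
      (((IsZero.iff_id_eq_zero _).2 this).eq_of_src _ _)

/-- The source of the monomorphism of the refined 5-lemma, in terms of chosen kernels and
cokernels. -/
theorem nonempty_source_iso (P : D.Premise) {Kε Kζ R K C X : 𝓑}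
    (jε : Kε ⟶ D.b) (hε : jε ≫ D.ε = 0)
    (hε' : IsLimit (KernelFork.ofι jε hε))
    (jζ : Kζ ⟶ D.c) (hζ : jζ ≫ D.ζ = 0)
    (hζ' : IsLimit (KernelFork.ofι jζ hζ))
    (π : D.c ⟶ R) (hπ : D.β ≫ π = 0) (hπ' : IsColimit (CokernelCofork.ofπ π hπ))
    (β' : Kε ⟶ Kζ) (hβ' : β' ≫ jζ = jε ≫ D.β)
    (π' : Kζ ⟶ R) (hπ'' : jζ ≫ π = π')
    (k : K ⟶ Kζ) (hk : k ≫ π' = 0) (hk' : IsLimit (KernelFork.ofι k hk))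
    (q : Kζ ⟶ C) (hq : β' ≫ q = 0) (hq' : IsColimit (CokernelCofork.ofπ q hq))
    (e : K ⟶ X) [Epi e] (m : X ⟶ C) [Mono m] (h : k ≫ q = e ≫ m) :
    Nonempty (source P ≅ X) := by
  subst hπ''
  obtain ⟨φ, hφ⟩ := exists_iso_kernel hζ'
  obtain ⟨ψ, hψ⟩ := exists_iso_kernel hε'
  have hφψ : β' ≫ φ.hom = ψ.hom ≫ kerMap P := by
    rw [← cancel_mono (kernel.ι D.ζ)]
    simp [kerMap, hφ, reassoc_of% hψ, hβ']
  obtain ⟨d, hd⟩ := CokernelCofork.IsColimit.desc' hπ' _ (cokernel.condition D.β)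
  replace hd : π ≫ d = cokernel.π D.β := hd
  have : Mono k := mono_of_isLimit_fork hk'
  have : Epi q := epi_of_isColimit_cofork hq'
  refine nonempty_pairHomology_iso (k ≫ φ.hom) ?_ ?_ (φ.inv ≫ q) ?_ ?_ e m (by simpa using h)
  · rw [comp_kerToHomology_eq_zero_iff, Category.assoc, reassoc_of% hφ, ← hd]
    simpa using congrArg (· ≫ d) hk
  · intro T t ht
    rw [comp_kerToHomology_eq_zero_iff] at ht
    obtain ⟨l, hl⟩ := KernelFork.IsLimit.lift' hk' (t ≫ φ.inv) (by
      -- Vanishing in the standard cokernel of β is transported to the chosen cokernel `R`.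
      have : cokernel.π D.β ≫ cokernel.desc D.β π hπ = π := by simp
      rw [← this, ← hφ]
      simpa using congrArg (· ≫ cokernel.desc D.β π hπ) ht)
    replace hl : l ≫ k = t ≫ φ.inv := hl
    exact ⟨l, by simp [reassoc_of% hl]⟩
  · rw [← cancel_epi ψ.hom, ← reassoc_of% hφψ]
    simpa using hq
  · intro T t ht
    obtain ⟨l, hl⟩ := CokernelCofork.IsColimit.desc' hq' (φ.hom ≫ t) (by
      rw [reassoc_of% hφψ, ht, comp_zero])
    replace hl : q ≫ l = φ.hom ≫ t := hl
    exact ⟨l, by simp [hl]⟩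

/-- The target of the monomorphism of the refined 5-lemma is the cokernel of
`a ⊕ ker β → ker ι`. -/
theorem nonempty_target_iso (P : D.Premise) {Kβ Kι Y : 𝓑}
    (jβ : Kβ ⟶ D.b) (hβ : jβ ≫ D.β = 0) (hβ' : IsLimit (KernelFork.ofι jβ hβ))
    (jι : Kι ⟶ D.f) (hι : jι ≫ D.ι = 0) (hι' : IsLimit (KernelFork.ofι jι hι))
    (s : D.a ⟶ Kι) (hs : s ≫ jι = D.α ≫ D.ε)
    (t : Kβ ⟶ Kι) (ht : t ≫ jι = jβ ≫ D.ε)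
    (e : Kι ⟶ Y) [Epi e] (hse : s ≫ e = 0) (hte : t ≫ e = 0)
    (he : ∀ {T : 𝓑} (y : Kι ⟶ T), s ≫ y = 0 → t ≫ y = 0 → ∃ l, e ≫ l = y) :
    Nonempty (target P ≅ Y) := by
  obtain ⟨φ, hφ⟩ := exists_iso_kernel hι'
  obtain ⟨ψ, hψ⟩ := exists_iso_kernel hβ'
  have hφψ : ψ.hom ≫ kernel.map D.β D.ι D.ε D.ζ P.comm₂ = t ≫ φ.hom := by
    rw [← cancel_mono (kernel.ι D.ι)]
    simp [hφ, reassoc_of% hψ, ht]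
  let p := factorThruImage (kernel.ι D.ι ≫ cokernel.π D.θ)
  have hp : p ≫ image.ι _ = kernel.ι D.ι ≫ cokernel.π D.θ := image.fac _
  have hH : factorThruImage (kernel.ι D.β ≫ cokernel.π D.α) ≫ homologyMap P =
      kernel.map D.β D.ι D.ε D.ζ P.comm₂ ≫ p := factorThruImage_pairHomologyMap _ _ _ _ _
  -- An element of ker ι that dies in H(θ, ι) lies locally in the image of θ. As δ is epi, its
  -- preimage lifts further to a, so the element comes from `s`, which `e` kills. This is where the
  -- surjectivity of δ enters.
  have hker : kernel.ι p ≫ φ.inv ≫ e = 0 := by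
    have hx : (kernel.ι p ≫ kernel.ι D.ι) ≫ cokernel.π D.θ = 0 := by
      rw [Category.assoc]
      exact (congrArg (kernel.ι p ≫ ·) hp).symm.trans (by simp)
    obtain ⟨A, π, _, y, hy⟩ := (ShortComplex.exact_cokernel D.θ).exact_up_to_refinements _ hx
    have := P.epi_δ
    obtain ⟨A', π', _, y', hy'⟩ := surjective_up_to_refinements_of_epi D.δ y
    rw [← cancel_epi π, ← cancel_epi π']
    have hk : π' ≫ π ≫ kernel.ι p = y' ≫ s ≫ φ.hom := by
      rw [← cancel_mono (kernel.ι D.ι)]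
      simp only [Category.assoc, hφ, hs]
      dsimp at hy
      rw [hy, reassoc_of% hy', P.comm₁]
    rw [reassoc_of% hk]
    simp [hse]
  obtain ⟨w, hw⟩ : ∃ w, p ≫ w = φ.inv ≫ e :=
    ⟨Abelian.epiDesc p _ hker, Abelian.comp_epiDesc p _ hker⟩
  -- Vanishing on H(α, β) can be tested on ker β, which covers it and acts on ker ι through `t`.
  obtain ⟨u, hu⟩ : ∃ u, cokernel.π (homologyMap P) ≫ u = w := by
    refine ⟨cokernel.desc _ w ?_, cokernel.π_desc _ _ _⟩
    rw [← cancel_epi (factorThruImage (kernel.ι D.β ≫ cokernel.π D.α)), reassoc_of% hH, hw,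
      ← cancel_epi ψ.hom, reassoc_of% hφψ]
    simp [hte]
  -- The inverse of `u`: ker ι → target kills `s` because s is δ followed by θ and so dies in coker
  -- θ, and kills `t` because that composite factors through H(ε).
  obtain ⟨v, hv⟩ := he (φ.hom ≫ p ≫ cokernel.π (homologyMap P)) (by
      have : s ≫ φ.hom ≫ p = 0 := by
        rw [← cancel_mono (image.ι _), Category.assoc, Category.assoc, hp, reassoc_of% hφ,
          reassoc_of% hs, reassoc_of% P.comm₁]
        exact (congrArg (D.δ ≫ ·) (cokernel.condition D.θ)).trans (by simp)
      rw [reassoc_of% this, zero_comp]) (by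
      have := congrArg (ψ.hom ≫ · ≫ cokernel.π (homologyMap P)) hH
      simpa [reassoc_of% hφψ] using this.symm)
  refine ⟨⟨u, v, ?_, ?_⟩⟩
  · rw [← cancel_epi (cokernel.π (homologyMap P)), ← cancel_epi p, ← cancel_epi φ.hom,
      reassoc_of% hu, reassoc_of% hw]
    simp [hv]
  · rw [← cancel_epi e, reassoc_of% hv, hu, hw]
    simp

end FiveDiagram

/-! ### Criteria for mono and epi, and kernels and cokernels of embedded morphisms -/

namespace Adel

noncomputable section

variable {A : Type u} [Category.{v} A] [Preadditive A]

section

variable {X Y : Adel A} {α : X.mid ⟶ Y.mid} {ω : X.r ⟶ Y.r} {ψ : X.c ⟶ Y.c}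
  {hω : X.ρ ≫ α = ω ≫ Y.ρ} {hψ : α ≫ Y.γ = X.γ ≫ ψ}

/-- A criterion for monomorphisms in the Adelman category. -/
theorem mono_homMk (σ₁ : X.mid ⟶ X.r) (σ₂ : Y.r ⟶ X.r) (p₁ : X.c ⟶ X.mid) (p₂ : Y.mid ⟶ X.mid)
    (h₁ : 𝟙 X.mid = σ₁ ≫ X.ρ + X.γ ≫ p₁ + α ≫ p₂) (h₂ : Y.ρ ≫ p₂ = σ₂ ≫ X.ρ) :
    Mono (homMk α ω ψ hω hψ) := by
  -- Up to the sign of `σ₂`, the hypotheses are the components of a witness pair for the vanishing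
  -- of `kerι`. The backward datum `p₂` has to respect relations only, so it need not define a
  -- morphism from `Y` to `X`.
  rw [Preadditive.mono_iff_cancel_zero]
  intro T τ h
  obtain ⟨τ, ω', ψ', hτ, hτ', rfl⟩ := exists_homMk τ
  rw [homMk_comp, homMk_eq_zero_iff] at h
  obtain ⟨s, t, h⟩ := h
  rw [homMk_eq_zero_iff]
  refine ⟨τ ≫ σ₁ + s ≫ σ₂, ψ' ≫ p₁ + t ≫ p₂, ?_⟩
  have h' : τ ≫ α ≫ p₂ = (s ≫ Y.ρ + T.γ ≫ t) ≫ p₂ := by rw [← h, Category.assoc]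
  have := congrArg (τ ≫ ·) h₁
  simp only [Preadditive.comp_add, Category.comp_id, h', reassoc_of% hτ', Preadditive.add_comp,
    Category.assoc, h₂] at this ⊢
  exact this.trans (by abel)

/-- A criterion for epimorphisms in the Adelman category. -/
theorem epi_homMk (σ₁ : Y.mid ⟶ X.mid) (σ₂ : Y.mid ⟶ Y.r) (p₁ : Y.c ⟶ Y.mid) (p₂ : Y.c ⟶ X.c)
    (h₁ : 𝟙 Y.mid = σ₂ ≫ Y.ρ + Y.γ ≫ p₁ + σ₁ ≫ α) (h₂ : σ₁ ≫ X.γ = Y.γ ≫ p₂) :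
    Epi (homMk α ω ψ hω hψ) := by
  rw [Preadditive.epi_iff_cancel_zero]
  intro T τ h
  obtain ⟨τ, ω', ψ', hτ, hτ', rfl⟩ := exists_homMk τ
  rw [homMk_comp, homMk_eq_zero_iff] at h
  obtain ⟨s, t, h⟩ := h
  rw [homMk_eq_zero_iff]
  refine ⟨σ₂ ≫ ω' + σ₁ ≫ s, p₁ ≫ τ + p₂ ≫ t, ?_⟩
  have := congrArg (· ≫ τ) h₁
  simp only [Preadditive.add_comp, Category.assoc, h, Category.id_comp, Preadditive.comp_add,
    reassoc_of% h₂, hτ] at this ⊢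
  exact this.trans (by abel)

end

variable [HasFiniteBiproducts A] {a b : A} (f : a ⟶ b)

theorem corel_hom_comp :
    (homMk (𝟙 a) 0 0 (by simp) (by simp) : corel f ⟶ emb a) ≫
      (homMk f 0 0 (by simp) (by simp) : emb a ⟶ emb b) = 0 := by
  rw [homMk_comp, homMk_eq_zero_iff]
  exact ⟨0, 𝟙 _, by simp⟩

/-- The object `(0 → a → b)` is the kernel of `(0 → a → 0) ⟶ (0 → b → 0)`. -/
theorem nonempty_isLimit_corel :
    Nonempty (IsLimit (KernelFork.ofι _ (corel_hom_comp f))) := by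
  have : Mono (homMk (𝟙 a) 0 0 (by simp) (by simp) : corel f ⟶ emb a) :=
    mono_homMk 0 0 0 (𝟙 _) (by simp) (by simp)
  refine ⟨KernelFork.IsLimit.ofι' _ _ fun k hk => Classical.indefiniteDescription _ ?_⟩
  obtain ⟨τ, ω', ψ', hτ, hτ', rfl⟩ := exists_homMk k
  rw [homMk_comp, homMk_eq_zero_iff] at hk
  obtain ⟨s, t, h⟩ := hk
  -- As `emb b` has zero relations, the witness pair for the vanishing of the composite reduces to
  -- `t`, which is precisely a corelation witness for a morphism into (0 → a → b).
  refine ⟨homMk (Y := corel f) τ ω' t hτ (by simpa using h), ?_⟩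
  rw [homMk_comp, homMk_eq_iff]
  exact ⟨0, 0, by simp⟩

theorem comp_rel_hom :
    (homMk f 0 0 (by simp) (by simp) : emb a ⟶ emb b) ≫
      (homMk (𝟙 b) 0 0 (by simp) (by simp) : emb b ⟶ rel f) = 0 := by
  rw [homMk_comp, homMk_eq_zero_iff]
  exact ⟨𝟙 _, 0, by simp⟩

/-- The object `(a → b → 0)` is the cokernel of `(0 → a → 0) ⟶ (0 → b → 0)`. -/
theorem nonempty_isColimit_rel :
    Nonempty (IsColimit (CokernelCofork.ofπ _ (comp_rel_hom f))) := by
  have : Epi (homMk (𝟙 b) 0 0 (by simp) (by simp) : emb b ⟶ rel f) :=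
    epi_homMk (𝟙 _) 0 0 0 (by simp) (by simp)
  refine ⟨CokernelCofork.IsColimit.ofπ' _ _ fun k hk => Classical.indefiniteDescription _ ?_⟩
  obtain ⟨τ, ω', ψ', hτ, hτ', rfl⟩ := exists_homMk k
  rw [homMk_comp, homMk_eq_zero_iff] at hk
  obtain ⟨s, t, h⟩ := hk
  -- Dually, `emb a` has zero corelations and `s` is the relation witness needed for a morphism out
  -- of (a → b → 0).
  refine ⟨homMk (X := rel f) τ s ψ' (by simpa using h) hτ', ?_⟩
  rw [homMk_comp, homMk_eq_iff]
  exact ⟨0, 0, by simp⟩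

end

end Adel

/-! ### The universal instance -/

namespace UniversalFive

noncomputable section

open Arr Adel Node

attribute [local instance] hasBinaryBiproducts_of_finite_biproducts

/-! ### Matrix calculus for rows and columns -/

section MatrixCalculus

variable {x w : Node} {m n : ℕ} {x' : Fin m → Node} {y : Fin n → Node}

/-- A row, as a morphism from a node. -/
def ofRow (r : Row (ob x) y) : sg x ⟶ tup y := fun _ => r

/-- A one-column matrix, as a morphism to a node. -/
def ofCol (M : ∀ k, Row (ob (x' k)) ![w]) : tup x' ⟶ sg w := fun k _ => M k 0

/-- Sum of matrices. -/
def addMat (M N : ∀ k, Row (ob (x' k)) y) : ∀ k, Row (ob (x' k)) y := fun k => addRow (M k) (N k)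

theorem addMat_cons (r s : Row (ob x) y) (M N : ∀ k, Row (ob (x' k)) y) :
    addMat (r ∷∷ M) (s ∷∷ N) = addRow r s ∷∷ addMat M N := by
  funext k
  induction k using Fin.cases <;> rfl

theorem addMat_nil : addMat (noRows (y := y)) noRows = noRows := by
  funext k
  exact k.elim0

theorem ofRows_add (M N : ∀ k, Row (ob (x' k)) y) : ofRows M + ofRows N = ofRows (addMat M N) := rfl

theorem ofRow_add (r s : Row (ob x) y) : ofRow r + ofRow s = ofRow (addRow r s) := rfl

theorem ofCol_add (M N : ∀ k, Row (ob (x' k)) ![w]) : ofCol M + ofCol N = ofCol (addMat M N) := rfl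

theorem ofRow_comp_ofRows {p : ℕ} {z : Fin p → Node} (r : Row (ob x) y)
    (N : ∀ k, Row (ob (y k)) z) : ofRow r ≫ ofRows N = ofRow (rowMul r N) := rfl

theorem ofRows_comp_ofCol (M : ∀ k, Row (ob (x' k)) y) (N : ∀ k, Row (ob (y k)) ![w]) :
    ofRows M ≫ ofCol N = ofCol (matMul M N) := rfl

/-- A node `sg w` is indexed by `PUnit`, not by `Fin 1`. The one-term sums over the two index types
agree, which brings the product back into the form of `matMul`. -/
theorem ofCol_comp_ofRow (M : ∀ k, Row (ob (x' k)) ![w]) (r : Row (ob w) y) :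
    ofCol M ≫ ofRow r = ofRows (matMul M (r ∷∷ noRows)) := by
  funext k l
  exact (Fintype.sum_unique (ι := PUnit) fun _ => M k 0 ≫ r l).trans
    (Fin.sum_univ_one fun j => M k j ≫ (r ∷∷ noRows) j l).symm

theorem map_comp_ofRow (f : ob x ⟶ ob w) (r : Row (ob w) y) :
    (Mat_.embedding CQR).map f ≫ ofRow r = ofRow (smulRow f r) := by
  funext k l
  exact Fintype.sum_unique (ι := PUnit) fun _ => f ≫ r l

theorem ofCol_comp_map (M : ∀ k, Row (ob (x' k)) ![w]) {z : Node} (f : ob w ⟶ ob z) :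
    ofCol M ≫ (Mat_.embedding CQR).map f =
      ofCol (matMul M ((f ∷ emptyRow : Row (ob w) ![z]) ∷∷ noRows)) := by
  funext k l
  exact (Fintype.sum_unique (ι := PUnit) fun _ => M k 0 ≫ f).trans
    (Fin.sum_univ_one fun j => M k j ≫ ((f ∷ emptyRow : Row (ob w) ![z]) ∷∷ noRows) j 0).symm

theorem ofRow_comp_ofCol (r : Row (ob x) y) (M : ∀ k, Row (ob (y k)) ![w]) :
    ofRow r ≫ ofCol M = (Mat_.embedding CQR).map (rowMul r M 0) := rfl

theorem consRow_zero {X : CQR} (f : X ⟶ ob x) (r : Row X y) : (f ∷ r) 0 = f := rfl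

theorem id_tup₂ (x₁ x₂ : Node) :
    𝟙 (tup ![x₁, x₂]) = ofRows ((𝟙 _ ∷ 0 ∷ emptyRow) ∷∷ (0 ∷ 𝟙 _ ∷ emptyRow) ∷∷ noRows) := by
  funext k l
  fin_cases k <;> fin_cases l <;>
    first
    | exact Mat_.id_apply_self _ _
    | exact Mat_.id_apply_of_ne _ _ _ (Fin.ne_of_val_ne (by simp))

theorem id_tup₃ (x₁ x₂ x₃ : Node) :
    𝟙 (tup ![x₁, x₂, x₃]) = ofRows ((𝟙 _ ∷ 0 ∷ 0 ∷ emptyRow) ∷∷ (0 ∷ 𝟙 _ ∷ 0 ∷ emptyRow) ∷∷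
      (0 ∷ 0 ∷ 𝟙 _ ∷ emptyRow) ∷∷ noRows) := by
  funext k l
  fin_cases k <;> fin_cases l <;>
    first
    | exact Mat_.id_apply_self _ _
    | exact Mat_.id_apply_of_ne _ _ _ (Fin.ne_of_val_ne (by simp))

theorem id_tup₅ (x₁ x₂ x₃ x₄ x₅ : Node) :
    𝟙 (tup ![x₁, x₂, x₃, x₄, x₅]) = ofRows ((𝟙 _ ∷ 0 ∷ 0 ∷ 0 ∷ 0 ∷ emptyRow) ∷∷
      (0 ∷ 𝟙 _ ∷ 0 ∷ 0 ∷ 0 ∷ emptyRow) ∷∷ (0 ∷ 0 ∷ 𝟙 _ ∷ 0 ∷ 0 ∷ emptyRow) ∷∷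
      (0 ∷ 0 ∷ 0 ∷ 𝟙 _ ∷ 0 ∷ emptyRow) ∷∷ (0 ∷ 0 ∷ 0 ∷ 0 ∷ 𝟙 _ ∷ emptyRow) ∷∷ noRows) := by
  funext k l
  fin_cases k <;> fin_cases l <;>
    first
    | exact Mat_.id_apply_self _ _
    | exact Mat_.id_apply_of_ne _ _ _ (Fin.ne_of_val_ne (by simp))

end MatrixCalculus

/-! ### The premise -/

theorem diagram_premise : diagram.Premise where
  comm₁ := by
    rw [homMk_comp, homMk_comp, homMk_eq_iff]
    exact ⟨0, 0, by simp⟩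
  comm₂ := by
    rw [homMk_comp, homMk_comp, homMk_eq_iff]
    refine ⟨0, 0, ?_⟩
    rw [← Functor.map_comp, ← Functor.map_comp, ar_beta_zeta]
    simp
  comm₃ := by
    rw [homMk_comp, homMk_comp, homMk_eq_iff]
    exact ⟨0, 0, by simp⟩
  zero₁ := by
    rw [homMk_comp, homMk_eq_zero_iff]
    refine ⟨0, 0, ?_⟩
    rw [← Functor.map_comp, ar_alpha_beta]
    simp
  zero₂ := by
    rw [homMk_comp, homMk_eq_zero_iff]
    refine ⟨0, 0, ?_⟩
    rw [← Functor.map_comp, ← Functor.map_comp, reassoc_of% ar_beta_zeta, ar_iota_kappa]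
    simp
  zero₃ := by
    rw [homMk_comp, homMk_eq_zero_iff]
    refine ⟨0, 0, ?_⟩
    rw [← Functor.map_comp, ← Functor.map_comp, Category.assoc, ← ar_beta_zeta,
      reassoc_of% ar_alpha_beta]
    simp
  zero₄ := by
    rw [homMk_comp, homMk_eq_zero_iff]
    refine ⟨0, 0, ?_⟩
    rw [← Functor.map_comp, ar_iota_kappa]
    simp
  -- The identity of a serves as backward datum: it only has to respect corelations, and these are
  -- zero on both sides. Dually for η, where the relations are zero.
  epi_δ := epi_homMk (ω := 0) (ψ := 0) (hω := by simp) (hψ := by simp) (𝟙 _) 0 0 0 (by simp) (by simp)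
  mono_η := mono_homMk (ω := 0) (ψ := 0) (hω := by simp) (hψ := by simp) 0 0 0 (𝟙 _) (by simp) (by simp)

/-! ### The explicit monomorphism and its kernel -/

/-- A matrix computation. The relation αβ = 0 removes the entry -αβ that the fourth row of
`witness₁` contributes at the first summand c. -/
theorem id_kernelObj_mid :
    𝟙 kernelObj.mid = witness₁ ≫ kernelObj.ρ + kernelObj.γ ≫ witness₂ := by
  dsimp only
  unfold witness₁ witness₂ kernelρ kernelγ
  simp only [ofRows_comp, matMul_cons, matMul_nil, rowMul_cons, addRow_rowMul_nil, smulRow_cons,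
    smulRow_nil, addRow_cons, addRow_nil, ofRows_add, addMat_cons, addMat_nil, id_tup₅]
  simp [ar_alpha_beta]

theorem isZero_kernelObj : IsZero kernelObj :=
  (IsZero.iff_id_eq_zero _).2
    ((homMk_eq_zero_iff (ω := 𝟙 _) (ψ := 𝟙 _) (by simp) (by simp)).2
      ⟨witness₁, witness₂, id_kernelObj_mid⟩)

instance : Mono explicitMono := by
  -- The matrices are blocks of the witness pair of K. The first and, with opposite sign, the second
  -- are the first two columns of `witness₁`, in rows 1 to 3 and rows 4 to 5. The fourth, swapping f
  -- and c, is the first three columns of rows 4 to 5 of `witness₂`.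
  refine mono_homMk
    (ofRows ((0 ∷ 0 ∷ emptyRow) ∷∷ (0 ∷ 0 ∷ emptyRow) ∷∷ (-𝟙 _ ∷ 𝟙 _ ∷ emptyRow) ∷∷ noRows))
    (ofRows ((ar alpha ∷ 0 ∷ emptyRow) ∷∷ (𝟙 _ ∷ 0 ∷ emptyRow) ∷∷ noRows)) 0
    (ofRows ((0 ∷ 𝟙 _ ∷ 0 ∷ emptyRow) ∷∷ (𝟙 _ ∷ 0 ∷ 0 ∷ emptyRow) ∷∷ noRows)) ?_ ?_
  · rw [comp_zero, add_zero]
    dsimp only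
    unfold sourceρ datum
    simp only [ofRows_comp, matMul_cons, matMul_nil, rowMul_cons, addRow_rowMul_nil, smulRow_cons,
      smulRow_nil, addRow_cons, addRow_nil, ofRows_add, addMat_cons, addMat_nil, id_tup₃]
    simp
  · dsimp only
    unfold sourceρ targetρ
    simp only [ofRows_comp, matMul_cons, matMul_nil, rowMul_cons, addRow_rowMul_nil, smulRow_cons,
      smulRow_nil, addRow_cons, addRow_nil]
    simp [ar_alpha_beta]

theorem kernelEmb_comp_explicitMono : kernelEmb ≫ explicitMono = 0 :=
  isZero_kernelObj.eq_of_src _ _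

/-- K is zero and m is mono, so any morphism killed by m is zero and factors through K. -/
theorem nonempty_isLimit_kernelEmb :
    Nonempty (IsLimit (KernelFork.ofι kernelEmb kernelEmb_comp_explicitMono)) := by
  have : Mono kernelEmb := ⟨fun _ _ _ => isZero_kernelObj.eq_of_tgt _ _⟩
  refine ⟨KernelFork.IsLimit.ofι' _ _ fun k hk => ⟨0, ?_⟩⟩
  rw [← cancel_mono explicitMono, hk, zero_comp, zero_comp]

/-! ### The source of the monomorphism -/

theorem sgm_eps_iota : sgm eps ≫ sgm iota = sgm beta ≫ sgm zeta := by
  rw [← Functor.map_comp, ← Functor.map_comp, ar_beta_zeta]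

theorem sgm_alpha_eps_iota : (sgm alpha ≫ sgm eps) ≫ sgm iota = 0 := by
  rw [Category.assoc, sgm_eps_iota, ← Functor.map_comp, ← Functor.map_comp,
    reassoc_of% ar_alpha_beta, zero_comp, Functor.map_zero]

/-- The kernel of `(0 → c → g) ⟶ (b → c → 0)` maps onto `sourceObj`. -/
def toSource : kerObj (corel (sgm zeta)) (rel (sgm beta)) (𝟙 (sg c)) ⟶ sourceObj :=
  homMk (X := kerObj (corel (sgm zeta)) (rel (sgm beta)) (𝟙 (sg c))) (Y := sourceObj)
    (biprod.desc (ofRow (𝟙 _ ∷ 0 ∷ 0 ∷ emptyRow)) (ofRow (0 ∷ 0 ∷ 𝟙 _ ∷ emptyRow)))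
    (biprod.desc 0 (ofRow (0 ∷ 𝟙 _ ∷ emptyRow)))
    (biprod.desc (ofRow (𝟙 _ ∷ 0 ∷ 0 ∷ emptyRow)) (ofRow (0 ∷ 0 ∷ 𝟙 _ ∷ emptyRow)))
    (by
      dsimp only [sourceρ]
      apply biprod.hom_ext'
      · simp
      · simp only [biprod.inr_map_assoc, biprod.inr_desc, biprod.inr_desc_assoc, Category.id_comp]
        simp only [ofRow_comp_ofRows, rowMul_cons, addRow_rowMul_nil, smulRow_cons,
          smulRow_nil, addRow_cons, addRow_nil]
        simp)
    (by
      dsimp only [sourceγ]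
      apply biprod.hom_ext'
      · simp only [biprod.inl_desc_assoc, biprod.lift_desc]
        simp only [map_comp_ofRow, ofRow_comp_ofRows, rowMul_cons, addRow_rowMul_nil, smulRow_cons,
          smulRow_nil, addRow_cons, addRow_nil, ofRow_add, Category.id_comp]
        simp
      · simp only [biprod.inr_desc_assoc, biprod.lift_desc]
        simp only [map_comp_ofRow, ofRow_comp_ofRows, rowMul_cons, addRow_rowMul_nil, smulRow_cons,
          smulRow_nil, addRow_cons, addRow_nil, zero_comp, zero_add]
        simp)

/-- Only the summand f of the middle term c⊕f⊕b is missed, and `sourceγ` is the identity on it, so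
the projection to f is null by way of the corelations. -/
instance : Epi toSource := by
  refine epi_homMk (X := kerObj (corel (sgm zeta)) (rel (sgm beta)) (𝟙 (sg c))) (Y := sourceObj)
    (biprod.lift
      (ofCol ((𝟙 _ ∷ emptyRow) ∷∷ (0 ∷ emptyRow) ∷∷ (0 ∷ emptyRow) ∷∷ noRows))
      (ofCol ((0 ∷ emptyRow) ∷∷ (0 ∷ emptyRow) ∷∷ (𝟙 _ ∷ emptyRow) ∷∷ noRows)))
    0
    (ofRows ((0 ∷ 0 ∷ 0 ∷ emptyRow) ∷∷ (0 ∷ 𝟙 _ ∷ 0 ∷ emptyRow) ∷∷ (0 ∷ 0 ∷ 0 ∷ emptyRow) ∷∷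
      noRows))
    (biprod.lift
      (ofCol ((𝟙 _ ∷ emptyRow) ∷∷ (0 ∷ emptyRow) ∷∷ (0 ∷ emptyRow) ∷∷ noRows))
      (ofCol ((0 ∷ emptyRow) ∷∷ (0 ∷ emptyRow) ∷∷ (𝟙 _ ∷ emptyRow) ∷∷ noRows))) ?_ ?_
  · dsimp only [sourceγ]
    rw [zero_comp, zero_add, biprod.lift_desc]
    simp only [ofRows_comp, ofCol_comp_ofRow, matMul_cons, matMul_nil, rowMul_cons,
      addRow_rowMul_nil, smulRow_cons, smulRow_nil, addRow_cons, addRow_nil, ofRows_add,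
      addMat_cons, addMat_nil, id_tup₃]
    simp
  · dsimp only [sourceγ]
    apply biprod.hom_ext
    · simp only [biprod.lift_desc, Preadditive.add_comp, Category.assoc, biprod.lift_fst, comp_zero,
        add_zero]
      simp only [ofRows_comp_ofCol, ofCol_comp_map, matMul_cons, matMul_nil, rowMul_cons,
        addRow_rowMul_nil, smulRow_cons, smulRow_nil, addRow_cons, addRow_nil]
      simp
    · simp only [biprod.lift_desc, Preadditive.add_comp, Category.assoc, biprod.lift_snd,
        Category.comp_id]
      simp only [ofRows_comp_ofCol, ofCol_comp_map, matMul_cons, matMul_nil, rowMul_cons,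
        addRow_rowMul_nil, smulRow_cons, smulRow_nil, addRow_cons, addRow_nil, ofCol_add,
        addMat_cons, addMat_nil]
      simp

/-- The object `sourceObj` embeds into the cokernel of `(0 → b → f) ⟶ (0 → c → g)`. -/
def fromSource : sourceObj ⟶ cokerObj (corel (sgm eps)) (corel (sgm zeta)) (sgm beta) :=
  homMk (X := sourceObj) (Y := cokerObj (corel (sgm eps)) (corel (sgm zeta)) (sgm beta))
    (biprod.lift
      (ofCol ((𝟙 _ ∷ emptyRow) ∷∷ (0 ∷ emptyRow) ∷∷ (0 ∷ emptyRow) ∷∷ noRows))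
      (ofCol ((0 ∷ emptyRow) ∷∷ (𝟙 _ ∷ emptyRow) ∷∷ (0 ∷ emptyRow) ∷∷ noRows)))
    (biprod.lift 0 (ofCol ((𝟙 _ ∷ emptyRow) ∷∷ (0 ∷ emptyRow) ∷∷ noRows)))
    (biprod.lift
      (ofCol ((𝟙 _ ∷ emptyRow) ∷∷ (0 ∷ emptyRow) ∷∷ (0 ∷ emptyRow) ∷∷ noRows))
      (ofCol ((0 ∷ emptyRow) ∷∷ (𝟙 _ ∷ emptyRow) ∷∷ (0 ∷ emptyRow) ∷∷ noRows)))
    (by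
      dsimp only [sourceρ]
      apply biprod.hom_ext <;> simp only [biprod.lift_desc, Category.assoc, biprod.lift_fst,
        biprod.lift_snd, zero_comp, zero_add] <;>
      simp only [ofRows_comp_ofCol, ofCol_comp_map, matMul_cons, matMul_nil, rowMul_cons,
        addRow_rowMul_nil, smulRow_cons, smulRow_nil, addRow_cons, addRow_nil] <;>
      simp)
    (by
      dsimp only [sourceγ]
      apply biprod.hom_ext
      · simp only [Category.assoc, biprod.map_fst, biprod.lift_fst_assoc, biprod.lift_fst]
        simp only [ofRows_comp_ofCol, ofCol_comp_map, matMul_cons, matMul_nil, rowMul_cons,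
          addRow_rowMul_nil, smulRow_cons, smulRow_nil, addRow_cons, addRow_nil]
        simp
      · simp only [Category.assoc, biprod.map_snd, biprod.lift_snd, Category.comp_id]
        simp only [ofRows_comp_ofCol, matMul_cons, matMul_nil, rowMul_cons,
          addRow_rowMul_nil, smulRow_cons, smulRow_nil, addRow_cons, addRow_nil]
        simp)

/-- Only the summand b is forgotten, and the second row of `sourceρ` is its inclusion, so everything
in it is null by way of the relations. -/
instance : Mono fromSource := by
  refine mono_homMk (X := sourceObj)
    (Y := cokerObj (corel (sgm eps)) (corel (sgm zeta)) (sgm beta))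
    (ofRows ((0 ∷ 0 ∷ emptyRow) ∷∷ (0 ∷ 0 ∷ emptyRow) ∷∷ (0 ∷ 𝟙 _ ∷ emptyRow) ∷∷ noRows))
    (biprod.desc 0 (ofRow (𝟙 _ ∷ 0 ∷ emptyRow))) 0
    (biprod.desc (ofRow (𝟙 _ ∷ 0 ∷ 0 ∷ emptyRow)) (ofRow (0 ∷ 𝟙 _ ∷ 0 ∷ emptyRow))) ?_ ?_
  · dsimp only [sourceρ]
    rw [comp_zero, add_zero, biprod.lift_desc]
    simp only [ofRows_comp, ofCol_comp_ofRow, matMul_cons, matMul_nil, rowMul_cons,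
      addRow_rowMul_nil, smulRow_cons, smulRow_nil, addRow_cons, addRow_nil, ofRows_add,
      addMat_cons, addMat_nil, id_tup₃]
    simp
  · dsimp only [sourceρ]
    apply biprod.hom_ext'
    · simp
    · simp only [biprod.inr_desc_assoc, biprod.lift_desc]
      simp only [map_comp_ofRow, ofRow_comp_ofRows, rowMul_cons, addRow_rowMul_nil, smulRow_cons,
        smulRow_nil, addRow_cons, addRow_nil, ofRow_add]
      simp

theorem toSource_comp_fromSource :
    kerι (corel (sgm zeta)) (rel (sgm beta)) (𝟙 (sg c)) ≫
      cokerπ (corel (sgm eps)) (corel (sgm zeta)) (sgm beta) = toSource ≫ fromSource := by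
  unfold kerι cokerπ toSource fromSource
  rw [homMk_comp, homMk_comp, homMk_eq_iff]
  refine ⟨0, 0, ?_⟩
  rw [zero_comp, comp_zero, add_zero, sub_eq_zero]
  dsimp only
  apply biprod.hom_ext' <;> apply biprod.hom_ext
  · simp only [Category.assoc, biprod.inl_fst_assoc, biprod.inl_desc_assoc, biprod.lift_fst,
      biprod.inl_fst, ofRow_comp_ofCol, rowMul_cons, addRow_rowMul_nil, smulRow_cons, smulRow_nil,
      addRow_cons, addRow_nil, consRow_zero]
    simp
  · simp only [Category.assoc, biprod.inl_fst_assoc, biprod.inl_desc_assoc, biprod.lift_snd,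
      biprod.inl_snd, ofRow_comp_ofCol, rowMul_cons, addRow_rowMul_nil, smulRow_cons, smulRow_nil,
      addRow_cons, addRow_nil, consRow_zero]
    simp
  · simp only [Category.assoc, biprod.inr_fst_assoc, biprod.inr_desc_assoc, biprod.lift_fst,
      biprod.inl_fst, ofRow_comp_ofCol, rowMul_cons, addRow_rowMul_nil, smulRow_cons, smulRow_nil,
      addRow_cons, addRow_nil, consRow_zero]
    simp
  · simp only [Category.assoc, biprod.inr_fst_assoc, biprod.inr_desc_assoc, biprod.lift_snd,
      biprod.inl_snd, ofRow_comp_ofCol, rowMul_cons, addRow_rowMul_nil, smulRow_cons, smulRow_nil,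
      addRow_cons, addRow_nil, consRow_zero]
    simp

theorem nonempty_source_iso (P : diagram.Premise) :
    Nonempty (FiveDiagram.source P ≅ sourceObj) := by
  obtain ⟨hε⟩ := nonempty_isLimit_corel (sgm eps)
  obtain ⟨hζ⟩ := nonempty_isLimit_corel (sgm zeta)
  obtain ⟨hβ⟩ := nonempty_isColimit_rel (sgm beta)
  refine FiveDiagram.nonempty_source_iso P _ _ hε _ _ hζ _ _ hβ
    -- The induced morphism ker ε → ker ζ has datum β, with ι as corelation witness because βζ = ει.
    -- The morphism ker ζ → coker β below has datum id_c.
    (homMk (X := corel (sgm eps)) (Y := corel (sgm zeta)) (sgm beta) 0 (sgm iota) (by simp)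
      sgm_eps_iota.symm) ?_
    (homMk (X := corel (sgm zeta)) (Y := rel (sgm beta)) (𝟙 (sg c)) 0 0 (by simp) (by simp)) ?_
    _ _ (kerIsLimit _ _) _ _ (cokerIsColimit _ _) toSource fromSource toSource_comp_fromSource
  · rw [homMk_comp, homMk_comp, homMk_eq_iff]
    exact ⟨0, 0, by simp⟩
  · rw [homMk_comp, homMk_eq_iff]
    exact ⟨0, 0, by simp⟩

/-! ### The target of the monomorphism -/

/-- The object `(0 → f → g)` maps onto `targetObj`. -/
def toTarget : corel (sgm iota) ⟶ targetObj :=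
  homMk (X := corel (sgm iota)) (Y := targetObj) (ofRow (𝟙 _ ∷ 0 ∷ emptyRow)) 0
    (ofRow (𝟙 _ ∷ 0 ∷ emptyRow)) (by simp) (by
      dsimp only [targetγ]
      simp only [map_comp_ofRow, ofRow_comp_ofRows, rowMul_cons, addRow_rowMul_nil, smulRow_cons,
        smulRow_nil, addRow_cons, addRow_nil]
      simp)

/-- The missed summand c carries an identity corelation and is therefore null. -/
instance : Epi toTarget := by
  refine epi_homMk (X := corel (sgm iota)) (Y := targetObj)
    (ofCol ((𝟙 _ ∷ emptyRow) ∷∷ (0 ∷ emptyRow) ∷∷ noRows)) 0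
    (ofRows ((0 ∷ 0 ∷ emptyRow) ∷∷ (0 ∷ 𝟙 _ ∷ emptyRow) ∷∷ noRows))
    (ofCol ((𝟙 _ ∷ emptyRow) ∷∷ (0 ∷ emptyRow) ∷∷ noRows)) ?_ ?_
  · dsimp only [targetγ]
    rw [zero_comp, zero_add]
    simp only [ofRows_comp, ofCol_comp_ofRow, matMul_cons, matMul_nil, rowMul_cons,
      addRow_rowMul_nil, smulRow_cons, smulRow_nil, addRow_cons, addRow_nil, ofRows_add,
      addMat_cons, addMat_nil, id_tup₂]
    simp
  · dsimp only [targetγ]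
    simp only [ofRows_comp_ofCol, ofCol_comp_map, matMul_cons, matMul_nil, rowMul_cons,
      addRow_rowMul_nil, smulRow_cons, smulRow_nil, addRow_cons, addRow_nil]
    simp

theorem targetρ_fst :
    targetρ ≫ ofCol ((𝟙 _ ∷ emptyRow) ∷∷ (0 ∷ emptyRow) ∷∷ noRows) =
      ofCol ((𝟙 _ ∷ emptyRow) ∷∷ (0 ∷ emptyRow) ∷∷ noRows) ≫ sgm alpha ≫ sgm eps +
      ofCol ((0 ∷ emptyRow) ∷∷ (𝟙 _ ∷ emptyRow) ∷∷ noRows) ≫ sgm eps := by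
  rw [← Functor.map_comp]
  unfold targetρ
  simp only [ofRows_comp_ofCol, ofCol_comp_map, matMul_cons, matMul_nil, rowMul_cons,
    addRow_rowMul_nil, smulRow_cons, smulRow_nil, addRow_cons, addRow_nil, ofCol_add, addMat_cons,
    addMat_nil]
  simp

theorem targetρ_snd :
    targetρ ≫ ofCol ((0 ∷ emptyRow) ∷∷ (𝟙 _ ∷ emptyRow) ∷∷ noRows) =
      ofCol ((0 ∷ emptyRow) ∷∷ (𝟙 _ ∷ emptyRow) ∷∷ noRows) ≫ sgm beta := by
  unfold targetρ
  simp only [ofRows_comp_ofCol, ofCol_comp_map, matMul_cons, matMul_nil, rowMul_cons,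
    addRow_rowMul_nil, smulRow_cons, smulRow_nil, addRow_cons, addRow_nil]
  simp

theorem targetγ_fst :
    targetγ ≫ ofCol ((𝟙 _ ∷ emptyRow) ∷∷ (0 ∷ emptyRow) ∷∷ noRows) =
      ofCol ((𝟙 _ ∷ emptyRow) ∷∷ (0 ∷ emptyRow) ∷∷ noRows) ≫ sgm iota := by
  unfold targetγ
  simp only [ofRows_comp_ofCol, ofCol_comp_map, matMul_cons, matMul_nil, rowMul_cons,
    addRow_rowMul_nil, smulRow_cons, smulRow_nil, addRow_cons, addRow_nil]
  simp

theorem targetγ_snd :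
    targetγ ≫ ofCol ((0 ∷ emptyRow) ∷∷ (𝟙 _ ∷ emptyRow) ∷∷ noRows) =
      ofCol ((0 ∷ emptyRow) ∷∷ (𝟙 _ ∷ emptyRow) ∷∷ noRows) := by
  unfold targetγ
  simp only [ofRows_comp_ofCol, matMul_cons, matMul_nil, rowMul_cons,
    addRow_rowMul_nil, smulRow_cons, smulRow_nil, addRow_cons, addRow_nil]
  simp

theorem row_fst (x y : Node) :
    ofRow (𝟙 _ ∷ 0 ∷ emptyRow) ≫ ofCol (x' := ![x, y])
      ((𝟙 _ ∷ emptyRow) ∷∷ (0 ∷ emptyRow) ∷∷ noRows) = 𝟙 (sg x) := by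
  rw [ofRow_comp_ofCol]
  simp only [rowMul_cons, addRow_rowMul_nil, smulRow_cons,
    smulRow_nil, addRow_cons, addRow_nil, consRow_zero]
  simp

theorem row_snd (x y : Node) :
    (ofRow (𝟙 _ ∷ 0 ∷ emptyRow) : sg x ⟶ _) ≫ ofCol (x' := ![x, y])
      ((0 ∷ emptyRow) ∷∷ (𝟙 _ ∷ emptyRow) ∷∷ noRows) = 0 := by
  rw [ofRow_comp_ofCol]
  simp only [rowMul_cons, addRow_rowMul_nil, smulRow_cons,
    smulRow_nil, addRow_cons, addRow_nil, consRow_zero]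
  simp

/-- The purpose of the summand c of Y: a morphism y on ker ι vanishes on ker β only up to a
correction β `t₂`, with `t₂` defined on c. Extending the datum of y by -`t₂` on c turns this into
compatibility with the relation row (ε, β). Vanishing on a gives compatibility with (αε, 0). -/
theorem toTarget_desc {T : Adel CQRplus} (y : corel (sgm iota) ⟶ T)
    (hs : (homMk (sgm alpha ≫ sgm eps) 0 0 (by simp)
      (sgm_alpha_eps_iota.trans zero_comp.symm) : emb (sg a) ⟶ corel (sgm iota)) ≫ y = 0)
    (ht : (homMk (sgm eps) 0 (sgm zeta) (by simp) sgm_eps_iota :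
      corel (sgm beta) ⟶ corel (sgm iota)) ≫ y = 0) :
    ∃ l, toTarget ≫ l = y := by
  obtain ⟨τ, ω', ψ', hτ, hτ', rfl⟩ := exists_homMk y
  rw [homMk_comp, homMk_eq_zero_iff] at hs ht
  obtain ⟨s₁, t₁, h₁⟩ := hs
  obtain ⟨s₂, t₂, h₂⟩ := ht
  rw [zero_comp, add_zero] at h₁
  refine ⟨homMk (X := targetObj)
    (ofCol ((𝟙 _ ∷ emptyRow) ∷∷ (0 ∷ emptyRow) ∷∷ noRows) ≫ τ -
      ofCol ((0 ∷ emptyRow) ∷∷ (𝟙 _ ∷ emptyRow) ∷∷ noRows) ≫ t₂)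
    (ofCol ((𝟙 _ ∷ emptyRow) ∷∷ (0 ∷ emptyRow) ∷∷ noRows) ≫ s₁ +
      ofCol ((0 ∷ emptyRow) ∷∷ (𝟙 _ ∷ emptyRow) ∷∷ noRows) ≫ s₂)
    (ofCol ((𝟙 _ ∷ emptyRow) ∷∷ (0 ∷ emptyRow) ∷∷ noRows) ≫ ψ' -
      ofCol ((0 ∷ emptyRow) ∷∷ (𝟙 _ ∷ emptyRow) ∷∷ noRows) ≫ t₂ ≫ T.γ) ?_ ?_, ?_⟩
  · dsimp only
    rw [Preadditive.comp_sub, reassoc_of% targetρ_fst, reassoc_of% targetρ_snd]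
    rw [Category.assoc] at h₁
    simp only [Preadditive.add_comp, Category.assoc]
    rw [h₁, h₂, Preadditive.comp_add]
    abel
  · dsimp only
    rw [Preadditive.comp_sub, reassoc_of% targetγ_fst, reassoc_of% targetγ_snd,
      Preadditive.sub_comp, Category.assoc, Category.assoc, hτ']
  · unfold toTarget
    rw [homMk_comp, homMk_eq_iff]
    refine ⟨0, 0, ?_⟩
    dsimp only
    rw [Preadditive.comp_sub, reassoc_of% row_fst, reassoc_of% row_snd]
    simp

theorem toTarget_zero_left :
    (homMk (sgm alpha ≫ sgm eps) 0 0 (by simp) (sgm_alpha_eps_iota.trans zero_comp.symm) :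
      emb (sg a) ⟶ corel (sgm iota)) ≫ toTarget = 0 := by
  unfold toTarget
  rw [homMk_comp, homMk_eq_zero_iff]
  refine ⟨ofRow (𝟙 _ ∷ 0 ∷ emptyRow), 0, ?_⟩
  dsimp only [targetρ]
  rw [← Functor.map_comp, comp_zero, add_zero]
  simp only [map_comp_ofRow, ofRow_comp_ofRows, rowMul_cons, addRow_rowMul_nil, smulRow_cons,
    smulRow_nil, addRow_cons, addRow_nil]
  simp

theorem toTarget_zero_right :
    (homMk (sgm eps) 0 (sgm zeta) (by simp) sgm_eps_iota :
      corel (sgm beta) ⟶ corel (sgm iota)) ≫ toTarget = 0 := by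
  unfold toTarget
  rw [homMk_comp, homMk_eq_zero_iff]
  -- (ε, 0) is the relation row (ε, β) minus (0, β), and the latter factors through the corelation β
  -- of ker β.
  refine ⟨ofRow (0 ∷ 𝟙 _ ∷ emptyRow), ofRow (0 ∷ (-𝟙 _) ∷ emptyRow), ?_⟩
  dsimp only [targetρ]
  simp only [map_comp_ofRow, ofRow_comp_ofRows, rowMul_cons, addRow_rowMul_nil, smulRow_cons,
    smulRow_nil, addRow_cons, addRow_nil, ofRow_add]
  simp

theorem nonempty_target_iso (P : diagram.Premise) :
    Nonempty (FiveDiagram.target P ≅ targetObj) := by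
  obtain ⟨hβ⟩ := nonempty_isLimit_corel (sgm beta)
  obtain ⟨hι⟩ := nonempty_isLimit_corel (sgm iota)
  refine FiveDiagram.nonempty_target_iso P _ _ hβ _ _ hι _ ?_ _ ?_ toTarget toTarget_zero_left
    toTarget_zero_right toTarget_desc
  · rw [homMk_comp, homMk_comp, homMk_eq_iff]
    exact ⟨0, 0, by simp⟩
  · rw [homMk_comp, homMk_comp, homMk_eq_iff]
    exact ⟨0, 0, by simp⟩

end

end UniversalFive

theorem mainTheorem6 :
    ∃ P : UniversalFive.diagram.Premise,
      FiveDiagram.Conclusion P ∧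
      Nonempty (FiveDiagram.source P ≅ UniversalFive.sourceObj) ∧
      Nonempty (FiveDiagram.target P ≅ UniversalFive.targetObj) ∧
      Mono UniversalFive.explicitMono ∧
      (∃ w : UniversalFive.kernelEmb ≫ UniversalFive.explicitMono = 0,
        Nonempty (IsLimit (KernelFork.ofι UniversalFive.kernelEmb w))) ∧
      𝟙 UniversalFive.kernelObj.mid =
        UniversalFive.witness₁ ≫ UniversalFive.kernelObj.ρ +
          UniversalFive.kernelObj.γ ≫ UniversalFive.witness₂ := by
  refine ⟨UniversalFive.diagram_premise, ?_, UniversalFive.nonempty_source_iso _,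
    UniversalFive.nonempty_target_iso _, inferInstance,
    ⟨UniversalFive.kernelEmb_comp_explicitMono, UniversalFive.nonempty_isLimit_kernelEmb⟩,
    UniversalFive.id_kernelObj_mid⟩
  obtain ⟨i⟩ := UniversalFive.nonempty_source_iso UniversalFive.diagram_premise
  obtain ⟨j⟩ := UniversalFive.nonempty_target_iso UniversalFive.diagram_premise
  -- The explicit monomorphism, transported along the isomorphisms with X and Y, is the one the
  -- refined 5-lemma asks for.
  exact FiveDiagram.Conclusion.of_mono _ (i.hom ≫ UniversalFive.explicitMono ≫ j.inv)
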